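/- Let $Q=(q_{ij})_{i,j\ge 0}$ be a totally stable and conservative single death rate matrix on $E=\{0,1,2,\dots\}$ with $0$ absorbing: all entries are real, $q_{ij}\ge 0$ for $i\ne j$, $\sum_{j\ge 0} q_{ij}=0$ for every $i$, $q_{0j}=0$ for all $j\ge 0$, and for every $i\ge 1$, $q_{i,i-1}>0$ and $q_{ij}=0$ whenever $j\le i-2$. Let $Y=(Y_t)_{t\ge 0}$ be the minimal continuous-time Markov chain with rate matrix $Q$ (sent to a cemetery at its explosion time), let $\mathbb P_i$, $\mathbb E_i$ refer to the start $Y_0=i$, and let $T_a=\inf\{t\ge 0: Y_t=a\}$. Let $\omega=(\omega_i)_{i\ge 1}$ be a non-negative function. Put $$q_n^{(k)}(\omega)=\sum_{j=k}^\infty q_{nj}+\omega_n,\qquad G_n^{(n)}(\omega)=1\ (n\ge 1),\qquad G_n^{(k)}(\omega)=\sum_{l=n+1}^{k}\frac{q_n^{(l)}(\omega)\,G_l^{(k)}(\omega)}{q_{n,n-1}}\ (k>n\ge 1),$$ and for $i,j\ge 0$ (empty sums being $0$) $$W^{(\omega)}(i,j)=\sum_{k=i+1}^{j}\frac{G_k^{(j)}(\omega)}{q_{j,j-1}},\qquad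 Z^{(\omega)}(i,j)=\begin{cases}1+\sum_{i<u<j}\omega_u W^{(\omega)}(i,u), & i<j,\\ 0,& i\ge j,\end{cases}$$ and $W=W^{(0)}$. Assume that $\mathbb P_i[T_0<\infty]=1$ for every $i\ge 1$. Then for all integers $i>a\ge 0$, $$\mathbb E_i\Big[\exp\Big(-\int_0^{T_a}\omega(Y_t)\,dt\Big)\Big]=\lim_{N\to\infty}\frac{W^{(\omega)}(i,N)}{W^{(\omega)}(a,N)}=\lim_{N\to\infty}\frac{Z^{(\omega)}(i,N)}{Z^{(\omega)}(a,N)},$$ where both limits exist. If in addition $\sum_{u=1}^\infty \omega_u W(0,u)<\infty$, then for every $i\ge 0$ $$Z^{(\omega)}(i,\infty):=1+\sum_{u=i+1}^\infty \omega_u W^{(\omega)}(i,u)<\infty,$$ and for all integers $i>a\ge 0$ $$\mathbb E_i\Big[\exp\Big(-\int_0^{T_a}\omega(Y_t)\,dt\Big)\Big]=\frac{Z^{(\omega)}(i,\infty)}{Z^{(\omega)}(a,\infty)}.$$ -/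

import Mathlib

open MeasureTheory Filter Topology
open scoped ENNReal NNReal

noncomputable section

namespace SingleDeath

/-- Conservative, totally stable single death rate matrices on `{0, 1, 2, …}` for which `0` is
absorbing: all entries are real (total stability) and every row sums to `0` (conservativity). -/
structure IsSingleDeathRate (q : ℕ → ℕ → ℝ) : Prop where
  nonneg : ∀ i j, i ≠ j → 0 ≤ q i j
  zero_row : ∀ j, q 0 j = 0
  down_pos : ∀ i, 1 ≤ i → 0 < q i (i - 1)
  skip_free : ∀ i j, j + 2 ≤ i → q i j = 0
  conservative : ∀ i, HasSum (fun j => q i j) 0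

/-- The total exit rate `q_i = -q_{ii}`. -/
def exitRate (q : ℕ → ℕ → ℝ) (i : ℕ) : ℝ := -q i i

/-- Transition probabilities of the embedded jump chain; states with exit rate `0` are
absorbing. -/
def jumpProb (q : ℕ → ℕ → ℝ) (i j : ℕ) : ℝ :=
  if exitRate q i = 0 then (if i = j then 1 else 0)
  else (if i = j then 0 else q i j / exitRate q i)

/-- `J 0, J 1, …` are the successively visited states and `S 0, S 1, …` the holding times of the
minimal continuous-time Markov chain with rate matrix `q`, where `P i` is the law under which the
chain starts at `i`: the visited states form a Markov chain with transition matrix `jumpProb q`,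
and given the visited states, the holding times are independent and exponential with parameters
`exitRate q (J k)` (infinite if the parameter is `0`). -/
structure IsMinimalChain (q : ℕ → ℕ → ℝ) {Ω : Type*} [MeasurableSpace Ω]
    (P : ℕ → Measure Ω) (J : ℕ → Ω → ℕ) (S : ℕ → Ω → ℝ≥0∞) : Prop where
  prob : ∀ i, IsProbabilityMeasure (P i)
  measurable_state : ∀ n, Measurable (J n)
  measurable_hold : ∀ n, Measurable (S n)
  law : ∀ (i n : ℕ) (x : ℕ → ℕ) (t : ℕ → ℝ≥0),
    P i {w | ∀ k ≤ n, J k w = x k ∧ (t k : ℝ≥0∞) < S k w} =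
      ENNReal.ofReal ((if x 0 = i then 1 else 0) *
        (∏ k ∈ Finset.range n, jumpProb q (x k) (x (k + 1))) *
        ∏ k ∈ Finset.range (n + 1), Real.exp (-(exitRate q (x k) * t k)))

/-- The time of the `n`-th jump, for holding times `s`. -/
def jumpTime (s : ℕ → ℝ≥0∞) (n : ℕ) : ℝ≥0∞ := ∑ k ∈ Finset.range n, s k

open Classical in
/-- The state at time `t` of the path that visits `x 0, x 1, …` with holding times `s 0, s 1, …`;
from the explosion time on the path is in the cemetery `none`. -/
def path (x : ℕ → ℕ) (s : ℕ → ℝ≥0∞) (t : ℝ≥0) : Option ℕ :=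
  if h : ∃ n, jumpTime s n ≤ (t : ℝ≥0∞) ∧ (t : ℝ≥0∞) < jumpTime s (n + 1) then
    some (x (Nat.find h))
  else none

/-- The process `Y_t`. -/
def process {Ω : Type*} (J : ℕ → Ω → ℕ) (S : ℕ → Ω → ℝ≥0∞) (t : ℝ≥0) (w : Ω) : Option ℕ :=
  path (fun n => J n w) (fun n => S n w) t

/-- The first hitting time `inf {t ≥ 0 : Y_t = a}` of the state `a` (`inf ∅ = ∞`). -/
def hittingTime {Ω : Type*} (Y : ℝ≥0 → Ω → Option ℕ) (a : ℕ) (w : Ω) : ℝ≥0∞ :=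
  sInf ((fun t : ℝ≥0 => (t : ℝ≥0∞)) '' {t | Y t w = some a})

/-- A function on the states, extended by `0` to the cemetery. -/
def extend (ω : ℕ → ℝ) (y : Option ℕ) : ℝ := y.elim 0 ω

/-- The integral `∫_0^{T_a} ω(Y_t) dt`, with values in `[0, ∞]`. -/
def additive {Ω : Type*} (Y : ℝ≥0 → Ω → Option ℕ) (ω : ℕ → ℝ) (a : ℕ) (w : Ω) : ℝ≥0∞ :=
  ∫⁻ t in {t : ℝ | 0 ≤ t ∧ ENNReal.ofReal t < hittingTime Y a w},
    ENNReal.ofReal (extend ω (Y t.toNNReal w))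

/-- `x ↦ e^{-x}` on `[0, ∞]`, with `e^{-∞} = 0`. -/
def expNeg (x : ℝ≥0∞) : ℝ := if x = ⊤ then 0 else Real.exp (-x.toReal)

/-- `q_n^{(k)}(ω) = ∑_{j ≥ k} q_{nj} + ω_n`. -/
def tail (q : ℕ → ℕ → ℝ) (ω : ℕ → ℝ) (n k : ℕ) : ℝ := (∑' j, q n (k + j)) + ω n

/-- `G_n^{(k)}(ω)`, meant for `1 ≤ n ≤ k`. -/
def G (q : ℕ → ℕ → ℝ) (ω : ℕ → ℝ) (n k : ℕ) : ℝ :=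
  if n = k then 1
  else ∑ l ∈ (Finset.Ioc n k).attach, tail q ω n l.1 * G q ω l.1 k / q n (n - 1)
termination_by k - n
decreasing_by
  have := Finset.mem_Ioc.mp l.2
  omega

theorem G_self (q : ℕ → ℕ → ℝ) (ω : ℕ → ℝ) (n : ℕ) : G q ω n n = 1 := by
  rw [G, if_pos rfl]

theorem G_of_lt (q : ℕ → ℕ → ℝ) (ω : ℕ → ℝ) {n k : ℕ} (h : n < k) :
    G q ω n k = ∑ l ∈ Finset.Ioc n k, tail q ω n l * G q ω l k / q n (n - 1) := by
  rw [G, if_neg h.ne]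
  exact Finset.sum_attach (Finset.Ioc n k) (fun l => tail q ω n l * G q ω l k / q n (n - 1))

/-- The scale function `W^{(ω)}(i, j)`. -/
def W (q : ℕ → ℕ → ℝ) (ω : ℕ → ℝ) (i j : ℕ) : ℝ :=
  ∑ k ∈ Finset.Ioc i j, G q ω k j / q j (j - 1)

/-- The function `Z^{(ω)}(i, j)`. -/
def Z (q : ℕ → ℕ → ℝ) (ω : ℕ → ℝ) (i j : ℕ) : ℝ :=
  if i < j then 1 + ∑ u ∈ Finset.Ioo i j, ω u * W q ω i u else 0

/-- `Z^{(ω)}(i, ∞) = 1 + ∑_{u ≥ i + 1} ω_u W^{(ω)}(i, u)`, meant for a convergent series. -/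
def ZInf (q : ℕ → ℕ → ℝ) (ω : ℕ → ℝ) (i : ℕ) : ℝ :=
  1 + ∑' u, ω (i + 1 + u) * W q ω i (i + 1 + u)

end SingleDeath

end

/-! Given the visited states, the holding times are independent and exponential, and an exponential
time `S` of rate `q_y` satisfies `E[exp (-ω_y S)] = q_y / (q_y + ω_y)`. Hence the Laplace transform
of `∫_0^{T_a} ω(Y_t) dt` is the probability that the jump chain, killed on each visit to `y` with
probability `ω_y / (q_y + ω_y)`, reaches `a`. As a function of the starting point this is the least
non-negative solution of `Q h = ω h` on `(a, ∞)` with `h(a) = 1`.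

The function `W^{(ω)}(·, N)` solves `Q f = ω f` on `[1, N)` and vanishes on `[N, ∞)`. Since the
chain cannot skip states on its way down, a minimum principle bounds `W^{(ω)}(i, N) / W^{(ω)}(a, N)`
by the hitting probability, while by Fatou's lemma the lower limit of these ratios is
superharmonic, hence at least the minimal solution. So the ratios converge to the Laplace
transform. `Z^{(ω)}(·, N)` solves the same equation with boundary value `1` on `[N, ∞)`, and the
minimum principle bounds the difference of the two ratios by `1 - W(i, N) / W(a, N)`, which tends
to `0` because `0` is reached almost surely.

For the value at infinity, the resolvent identity between `W^{(ω)}` and `W` yields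
`W^{(ω)}(i, u) ≤ W(0, u) Z^{(ω)}(i, u)`, and a discrete Grönwall argument bounds `Z^{(ω)}(i, N)`
uniformly in `N` as soon as `∑ ω_u W(0, u)` converges.
-/

noncomputable section

namespace SingleDeath

/-! ### Rates -/

section Rates

variable {q : ℕ → ℕ → ℝ}

theorem IsSingleDeathRate.hasSum_offDiag (hq : IsSingleDeathRate q) (i : ℕ) :
    HasSum (fun j => if i = j then 0 else q i j) (exitRate q i) := by
  have hupd := (hq.conservative i).update i 0
  rw [zero_sub, add_zero] at hupd
  refine hupd.congr_fun fun j => ?_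
  rcases eq_or_ne i j with rfl | hj
  · simp
  · simp [hj, Function.update_of_ne hj.symm]

theorem IsSingleDeathRate.exitRate_pos (hq : IsSingleDeathRate q) {i : ℕ} (hi : 1 ≤ i) :
    0 < exitRate q i := by
  have hle := le_hasSum (hq.hasSum_offDiag i) (i - 1) fun j _ => by
    split_ifs with hj
    · exact le_rfl
    · exact hq.nonneg i j hj
  rw [if_neg (by omega)] at hle
  exact (hq.down_pos i hi).trans_le hle

theorem IsSingleDeathRate.exitRate_nonneg (hq : IsSingleDeathRate q) (i : ℕ) :
    0 ≤ exitRate q i :=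
  (hq.hasSum_offDiag i).nonneg fun j => by
    split_ifs with hj
    · exact le_rfl
    · exact hq.nonneg i j hj

theorem IsSingleDeathRate.jumpProb_of_pos (hq : IsSingleDeathRate q) {i : ℕ} (hi : 1 ≤ i)
    (j : ℕ) : jumpProb q i j = if i = j then 0 else q i j / exitRate q i := by
  rw [jumpProb, if_neg (hq.exitRate_pos hi).ne']

theorem IsSingleDeathRate.jumpProb_zero (hq : IsSingleDeathRate q) (j : ℕ) :
    jumpProb q 0 j = if 0 = j then 1 else 0 := by
  rw [jumpProb, if_pos (by simp [exitRate, hq.zero_row])]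

theorem IsSingleDeathRate.jumpProb_nonneg (hq : IsSingleDeathRate q) (i j : ℕ) :
    0 ≤ jumpProb q i j := by
  rcases Nat.eq_zero_or_pos i with rfl | hi
  · rw [hq.jumpProb_zero]
    positivity
  · rw [hq.jumpProb_of_pos hi]
    split_ifs with hij
    · exact le_rfl
    · exact div_nonneg (hq.nonneg i j hij) (hq.exitRate_pos hi).le

theorem IsSingleDeathRate.jumpProb_eq_zero (hq : IsSingleDeathRate q) {i j : ℕ}
    (h : j + 2 ≤ i) : jumpProb q i j = 0 := by
  rw [hq.jumpProb_of_pos (by omega), if_neg (by omega), hq.skip_free i j h, zero_div]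

theorem IsSingleDeathRate.hasSum_jumpProb (hq : IsSingleDeathRate q) (i : ℕ) :
    HasSum (jumpProb q i) 1 := by
  rcases Nat.eq_zero_or_pos i with rfl | hi
  · refine (hasSum_ite_eq 0 (1 : ℝ)).congr_fun fun j => ?_
    simp only [hq.jumpProb_zero, eq_comm]
  · have hdiv := (hq.hasSum_offDiag i).div_const (exitRate q i)
    rw [div_self (hq.exitRate_pos hi).ne'] at hdiv
    refine hdiv.congr_fun fun j => ?_
    rw [hq.jumpProb_of_pos hi, ite_div, zero_div]

theorem hasSum_iff_tsum_ofReal_eq {ι : Type*} {f : ι → ℝ} {s : ℝ} (hf : ∀ j, 0 ≤ f j)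
    (hs : 0 ≤ s) : HasSum f s ↔ ∑' j, ENNReal.ofReal (f j) = ENNReal.ofReal s := by
  lift f to ι → ℝ≥0 using hf
  lift s to ℝ≥0 using hs
  simp only [NNReal.hasSum_coe, ENNReal.ofReal_coe_nnreal, ← ENNReal.hasSum_coe,
    ENNReal.summable.hasSum_iff]

theorem IsSingleDeathRate.tsum_ofReal_jumpProb (hq : IsSingleDeathRate q) (i : ℕ) :
    ∑' j, ENNReal.ofReal (jumpProb q i j) = 1 := by
  rw [← ENNReal.ofReal_one]
  exact (hasSum_iff_tsum_ofReal_eq (hq.jumpProb_nonneg i) zero_le_one).mp (hq.hasSum_jumpProb i)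

theorem IsSingleDeathRate.hasSum_rate_mul_iff (hq : IsSingleDeathRate q) {i : ℕ} (hi : 1 ≤ i)
    (f : ℕ → ℝ) (s : ℝ) : HasSum (fun j => q i j * f j) s ↔
      HasSum (fun j => jumpProb q i j * f j) (f i + s / exitRate q i) := by
  have hpos := (hq.exitRate_pos hi).ne'
  have hterm : ∀ j, jumpProb q i j * f j =
      q i j * f j / exitRate q i + if j = i then f i else 0 := by
    intro j
    rw [hq.jumpProb_of_pos hi]
    rcases eq_or_ne i j with rfl | hij
    · rw [if_pos rfl, if_pos rfl, ← neg_neg (q i i), ← exitRate]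
      field_simp
      ring
    · rw [if_neg hij, if_neg hij.symm, add_zero, div_mul_eq_mul_div]
  have hdiag := hasSum_ite_eq i (f i)
  simp_rw [hterm]
  constructor <;> intro h
  · simpa only [add_comm (f i)] using (h.div_const (exitRate q i)).add hdiag
  · simpa only [add_sub_cancel_right, add_sub_cancel_left, mul_div_cancel₀ _ hpos] using
      (h.sub hdiag).mul_left (exitRate q i)

theorem IsSingleDeathRate.sum_range_rate_of_lt (hq : IsSingleDeathRate q) {i k : ℕ}
    (hk : k < i) : ∑ j ∈ Finset.range k, q i j = 0 :=
  Finset.sum_eq_zero fun j hj => hq.skip_free i j (by have := Finset.mem_range.mp hj; omega)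

theorem IsSingleDeathRate.sum_range_rate_self (hq : IsSingleDeathRate q) {i : ℕ} (hi : 1 ≤ i) :
    ∑ j ∈ Finset.range i, q i j = q i (i - 1) := by
  obtain ⟨m, rfl⟩ := Nat.exists_eq_add_of_le' hi
  rw [Finset.sum_range_succ, hq.sum_range_rate_of_lt m.lt_succ_self, zero_add,
    Nat.add_sub_cancel]

theorem IsSingleDeathRate.sum_range_rate (hq : IsSingleDeathRate q) (ω : ℕ → ℝ) (i k : ℕ) :
    ∑ j ∈ Finset.range k, q i j = ω i - tail q ω i k := by
  have hsplit := (hq.conservative i).summable.sum_add_tsum_nat_add k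
  rw [(hq.conservative i).tsum_eq] at hsplit
  simp_rw [tail, add_comm k]
  linarith

end Rates

/-! ### Scale functions -/

section Scale

variable {q : ℕ → ℕ → ℝ} {ω : ℕ → ℝ}

theorem IsSingleDeathRate.tail_nonneg (hq : IsSingleDeathRate q) (hω : ∀ i, 1 ≤ i → 0 ≤ ω i)
    {n l : ℕ} (hn : 1 ≤ n) (hl : n < l) : 0 ≤ tail q ω n l :=
  add_nonneg (tsum_nonneg fun j => hq.nonneg _ _ (by omega)) (hω n hn)

theorem IsSingleDeathRate.G_nonneg (hq : IsSingleDeathRate q) (hω : ∀ i, 1 ≤ i → 0 ≤ ω i)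
    {n k : ℕ} (hn : 1 ≤ n) (hnk : n ≤ k) : 0 ≤ G q ω n k := by
  induction hm : k - n using Nat.strong_induction_on generalizing n with
  | _ m ih =>
    rcases hnk.eq_or_lt with rfl | hlt
    · rw [G_self]
      exact zero_le_one
    · rw [G_of_lt q ω hlt]
      refine Finset.sum_nonneg fun l hl => ?_
      obtain ⟨hnl, hlk⟩ := Finset.mem_Ioc.mp hl
      exact div_nonneg (mul_nonneg (hq.tail_nonneg hω hn hnl)
        (ih (k - l) (by omega) (by omega) hlk rfl)) (hq.down_pos n hn).le

theorem W_eq_zero (q : ℕ → ℕ → ℝ) (ω : ℕ → ℝ) {i j : ℕ} (h : j ≤ i) : W q ω i j = 0 := by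
  rw [W, Finset.Ioc_eq_empty_of_le h, Finset.sum_empty]

theorem IsSingleDeathRate.W_antitone (hq : IsSingleDeathRate q) (hω : ∀ i, 1 ≤ i → 0 ≤ ω i)
    (j : ℕ) : Antitone fun i => W q ω i j := by
  refine fun i i' h => Finset.sum_le_sum_of_subset_of_nonneg (Finset.Ioc_subset_Ioc_left h)
    fun k hk _ => ?_
  obtain ⟨hik, hkj⟩ := Finset.mem_Ioc.mp hk
  exact div_nonneg (hq.G_nonneg hω (by omega) hkj) (hq.down_pos j (by omega)).le

theorem IsSingleDeathRate.W_nonneg (hq : IsSingleDeathRate q) (hω : ∀ i, 1 ≤ i → 0 ≤ ω i)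
    (i j : ℕ) : 0 ≤ W q ω i j := by
  rw [← W_eq_zero q ω (le_max_right i j)]
  exact hq.W_antitone hω j (le_max_left i j)

theorem IsSingleDeathRate.W_pos (hq : IsSingleDeathRate q) (hω : ∀ i, 1 ≤ i → 0 ≤ ω i)
    {i j : ℕ} (h : i < j) : 0 < W q ω i j := by
  obtain ⟨m, rfl⟩ := Nat.exists_eq_add_of_le' (Nat.one_le_of_lt h)
  calc 0 < 1 / q (m + 1) m := one_div_pos.mpr (hq.down_pos (m + 1) m.succ_pos)
    _ = W q ω m (m + 1) := by simp [W, G_self]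
    _ ≤ W q ω i (m + 1) := hq.W_antitone hω (m + 1) (by omega)

theorem IsSingleDeathRate.weight_mul_W_nonneg (hq : IsSingleDeathRate q)
    (hω : ∀ i, 1 ≤ i → 0 ≤ ω i) {ω' : ℕ → ℝ} (hω' : ∀ i, 1 ≤ i → 0 ≤ ω' i) (i u : ℕ) :
    0 ≤ ω u * W q ω' i u := by
  rcases Nat.eq_zero_or_pos u with rfl | hu
  · rw [W_eq_zero q ω' (Nat.zero_le i), mul_zero]
  · exact mul_nonneg (hω u hu) (hq.W_nonneg hω' i u)

theorem sum_rate_mul_W (q : ℕ → ℕ → ℝ) (ω : ℕ → ℝ) (i u : ℕ) :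
    ∑ j ∈ Finset.range u, q i j * W q ω j u =
      ∑ k ∈ Finset.Ioc 0 u, (∑ j ∈ Finset.range k, q i j) * (G q ω k u / q u (u - 1)) := by
  simp_rw [W, Finset.mul_sum, Finset.sum_mul]
  refine Finset.sum_comm' fun j k => ?_
  simp only [Finset.mem_range, Finset.mem_Ioc]
  omega

theorem IsSingleDeathRate.rate_mul_G (hq : IsSingleDeathRate q) (ω : ℕ → ℝ) {i u : ℕ}
    (hi : 1 ≤ i) (hiu : i ≤ u) :
    q i (i - 1) * (G q ω i u / q u (u - 1)) =
      ∑ k ∈ Finset.Ioc i u, tail q ω i k * (G q ω k u / q u (u - 1)) +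
        if i = u then 1 else 0 := by
  have hpos := (hq.down_pos i hi).ne'
  rcases hiu.eq_or_lt with rfl | hlt
  · simp [G_self, hpos]
  · rw [if_neg hlt.ne, add_zero, G_of_lt q ω hlt, Finset.sum_div, Finset.mul_sum]
    exact Finset.sum_congr rfl fun k _ => by field_simp

theorem IsSingleDeathRate.hasSum_rate_mul_W (hq : IsSingleDeathRate q) (ω : ℕ → ℝ) {i : ℕ}
    (hi : 1 ≤ i) (u : ℕ) :
    HasSum (fun j => q i j * W q ω j u) (ω i * W q ω i u + if i = u then 1 else 0) := by
  have hfin : HasSum (fun j => q i j * W q ω j u) (∑ j ∈ Finset.range u, q i j * W q ω j u) :=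
    hasSum_sum_of_ne_finset_zero fun j hj => by
      rw [W_eq_zero q ω (by simpa using hj), mul_zero]
  convert hfin using 1
  rw [sum_rate_mul_W]
  have hlow : ∀ k < i, (∑ j ∈ Finset.range k, q i j) * (G q ω k u / q u (u - 1)) = 0 :=
    fun k hk => by rw [hq.sum_range_rate_of_lt hk, zero_mul]
  rcases lt_or_ge u i with hui | hiu
  · rw [W_eq_zero q ω hui.le, if_neg hui.ne', mul_zero, add_zero, Finset.sum_eq_zero]
    exact fun k hk => hlow k ((Finset.mem_Ioc.mp hk).2.trans_lt hui)
  · have hIoc : Finset.Ioc (i - 1) i = {i} := by ext; simp; omega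
    rw [← Finset.sum_Ioc_consecutive _ (i - 1).zero_le ((i.sub_le 1).trans hiu),
      ← Finset.sum_Ioc_consecutive _ (i.sub_le 1) hiu, hIoc, Finset.sum_singleton,
      Finset.sum_eq_zero fun k hk => hlow k (by have := Finset.mem_Ioc.mp hk; omega),
      hq.sum_range_rate_self hi, hq.rate_mul_G ω hi hiu, W, Finset.mul_sum]
    simp_rw [hq.sum_range_rate ω, sub_mul, Finset.sum_sub_distrib]
    ring

/-- `Z^{(ω)}(i, N)` with the value `1` instead of `0` for `i ≥ N`: this is the extension for which
`i ↦ Z^{(ω)}(i, N)` solves the harmonic equation at every state `1 ≤ i < N`. -/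
def ZBar (q : ℕ → ℕ → ℝ) (ω : ℕ → ℝ) (i N : ℕ) : ℝ :=
  1 + ∑ u ∈ Finset.range N, ω u * W q ω i u

theorem Z_eq_ZBar (q : ℕ → ℕ → ℝ) (ω : ℕ → ℝ) {i N : ℕ} (h : i < N) :
    Z q ω i N = ZBar q ω i N := by
  rw [Z, if_pos h, ZBar]
  congr 1
  refine Finset.sum_subset (fun u hu => ?_) fun u hu hu' => ?_
  · exact Finset.mem_range.mpr (Finset.mem_Ioo.mp hu).2
  · rw [Finset.mem_range] at hu
    rw [W_eq_zero q ω (by rw [Finset.mem_Ioo] at hu'; omega), mul_zero]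

theorem ZBar_eq_one (q : ℕ → ℕ → ℝ) (ω : ℕ → ℝ) {i N : ℕ} (h : N ≤ i) : ZBar q ω i N = 1 := by
  rw [ZBar, Finset.sum_eq_zero, add_zero]
  exact fun u hu => by rw [W_eq_zero q ω ((Finset.mem_range.mp hu).le.trans h), mul_zero]

theorem ZBar_succ (q : ℕ → ℕ → ℝ) (ω : ℕ → ℝ) (i N : ℕ) :
    ZBar q ω i (N + 1) = ZBar q ω i N + ω N * W q ω i N := by
  rw [ZBar, ZBar, Finset.sum_range_succ, add_assoc]

theorem IsSingleDeathRate.one_le_ZBar (hq : IsSingleDeathRate q) (hω : ∀ i, 1 ≤ i → 0 ≤ ω i)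
    (i N : ℕ) : 1 ≤ ZBar q ω i N :=
  le_add_of_nonneg_right (Finset.sum_nonneg fun u _ => hq.weight_mul_W_nonneg hω hω i u)

end Scale

/-! ### Harmonic functions -/

section Harmonic

variable {q : ℕ → ℕ → ℝ} {ω f g : ℕ → ℝ} {i : ℕ}

/-- `Q f = ω f` at the state `i`, that is, `f` is harmonic at `i` for the chain killed at rate
`ω`. -/
def IsHarmonicAt (q : ℕ → ℕ → ℝ) (ω f : ℕ → ℝ) (i : ℕ) : Prop :=
  HasSum (fun j => q i j * f j) (ω i * f i)

/-- `Q f ≤ ω f` at the state `i`, that is, `f` is superharmonic at `i` for the chain killed at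
rate `ω`; convergence of the series `(Q f)(i)` is part of the notion. -/
def IsSuperharmonicAt (q : ℕ → ℕ → ℝ) (ω f : ℕ → ℝ) (i : ℕ) : Prop :=
  ∃ s ≤ ω i * f i, HasSum (fun j => q i j * f j) s

theorem IsHarmonicAt.isSuperharmonicAt (hf : IsHarmonicAt q ω f i) :
    IsSuperharmonicAt q ω f i :=
  ⟨_, le_rfl, hf⟩

theorem IsSuperharmonicAt.sub (hf : IsSuperharmonicAt q ω f i) (hg : IsHarmonicAt q ω g i) :
    IsSuperharmonicAt q ω (fun j => f j - g j) i := by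
  obtain ⟨s, hs, hsum⟩ := hf
  refine ⟨s - ω i * g i, by linarith, ?_⟩
  simpa only [mul_sub] using hsum.sub hg

theorem IsHarmonicAt.sub (hf : IsHarmonicAt q ω f i) (hg : IsHarmonicAt q ω g i) :
    IsHarmonicAt q ω (fun j => f j - g j) i := by
  simpa only [IsHarmonicAt, mul_sub] using HasSum.sub hf hg

theorem IsHarmonicAt.div_const (hf : IsHarmonicAt q ω f i) (c : ℝ) :
    IsHarmonicAt q ω (fun j => f j / c) i := by
  simpa only [IsHarmonicAt, mul_div_assoc] using HasSum.div_const hf c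

theorem IsSingleDeathRate.isHarmonicAt_W (hq : IsSingleDeathRate q) (ω : ℕ → ℝ) {N : ℕ}
    (hi : 1 ≤ i) (hN : i ≠ N) : IsHarmonicAt q ω (fun j => W q ω j N) i := by
  simpa only [IsHarmonicAt, if_neg hN, add_zero] using hq.hasSum_rate_mul_W ω hi N

theorem IsSingleDeathRate.hasSum_rate_mul_sum_W (hq : IsSingleDeathRate q) (ω c : ℕ → ℝ) {N : ℕ}
    (hi : 1 ≤ i) :
    HasSum (fun j => q i j * ∑ u ∈ Finset.range N, c u * W q ω j u)
      (ω i * ∑ u ∈ Finset.range N, c u * W q ω i u + if i < N then c i else 0) := by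
  have hsum := hasSum_sum (s := Finset.range N) fun u _ =>
    (hq.hasSum_rate_mul_W ω hi u).mul_left (c u)
  simp only [mul_add, Finset.sum_add_distrib, mul_ite, mul_one, mul_zero, Finset.sum_ite_eq,
    Finset.mem_range, mul_left_comm (c _), ← Finset.mul_sum] at hsum
  exact hsum

theorem IsSingleDeathRate.isHarmonicAt_ZBar (hq : IsSingleDeathRate q) (ω : ℕ → ℝ) {N : ℕ}
    (hi : 1 ≤ i) (hN : i < N) : IsHarmonicAt q ω (fun j => ZBar q ω j N) i := by
  have hsum := (hq.conservative i).add (hq.hasSum_rate_mul_sum_W ω ω (N := N) hi)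
  rw [if_pos hN, zero_add] at hsum
  simpa only [IsHarmonicAt, ZBar, mul_add, mul_one, add_comm] using hsum

theorem IsSingleDeathRate.isSuperharmonicAt_one_sub (hq : IsSingleDeathRate q)
    (hf : IsHarmonicAt q 0 f i) (hω : 0 ≤ ω i) (hf1 : f i ≤ 1) :
    IsSuperharmonicAt q ω (fun j => 1 - f j) i := by
  refine ⟨0, mul_nonneg hω (sub_nonneg.mpr hf1), ?_⟩
  simpa [mul_sub] using (hq.conservative i).sub hf

/-- Only the step down can lead from `i` to a value below the minimum over `[i, ∞)`. -/
theorem IsSingleDeathRate.le_of_isSuperharmonicAt (hq : IsSingleDeathRate q) (hi : 1 ≤ i)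
    (hω : 0 ≤ ω i) (hf : IsSuperharmonicAt q ω f i) (hneg : f i ≤ 0)
    (hmin : ∀ j, i ≤ j → f i ≤ f j) : f (i - 1) ≤ f i := by
  obtain ⟨s, hs, hsum⟩ := hf
  have hdiff : HasSum (fun j => q i j * (f j - f i)) s := by
    simpa only [mul_sub, zero_mul, sub_zero] using hsum.sub ((hq.conservative i).mul_right (f i))
  have hterm : q i (i - 1) * (f (i - 1) - f i) ≤ s := by
    refine le_hasSum hdiff (i - 1) fun j hj => ?_
    rcases lt_trichotomy j i with h | rfl | h
    · rw [hq.skip_free i j (by omega), zero_mul]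
    · rw [sub_self, mul_zero]
    · exact mul_nonneg (hq.nonneg i j h.ne) (sub_nonneg.mpr (hmin j h.le))
  refine sub_nonpos.mp (nonpos_of_mul_nonpos_right ?_ (hq.down_pos i hi))
  exact hterm.trans (hs.trans (mul_nonpos_of_nonneg_of_nonpos hω hneg))

theorem IsSingleDeathRate.nonneg_of_isSuperharmonicAt (hq : IsSingleDeathRate q)
    (hω : ∀ i, 1 ≤ i → 0 ≤ ω i) {a N : ℕ} (ha : 0 ≤ f a) (hN : ∀ j, N ≤ j → 0 ≤ f j)
    (hf : ∀ i, a < i → i < N → IsSuperharmonicAt q ω f i) (hi : a ≤ i) : 0 ≤ f i := by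
  by_contra! hneg
  have hiN : i < N := lt_of_not_ge fun h => hneg.not_ge (hN i h)
  obtain ⟨m, hm, hmin⟩ :=
    Finset.exists_min_image (Finset.Ico a N) f ⟨i, Finset.mem_Ico.mpr ⟨hi, hiN⟩⟩
  obtain ⟨ham, hmN⟩ := Finset.mem_Ico.mp hm
  have hfm : f m < 0 := (hmin i (Finset.mem_Ico.mpr ⟨hi, hiN⟩)).trans_lt hneg
  have hmin' : ∀ j, a ≤ j → f m ≤ f j := fun j hj => (lt_or_ge j N).elim
    (fun h => hmin j (Finset.mem_Ico.mpr ⟨hj, h⟩)) fun h => hfm.le.trans (hN j h)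
  have hdown : ∀ k, a ≤ k → k ≤ m → f k ≤ f m := fun k hak hkm => by
    induction hkm using Nat.decreasingInduction with
    | self => exact le_rfl
    | of_succ k hk ih =>
      have hle := ih (by omega)
      exact (hq.le_of_isSuperharmonicAt k.succ_pos (hω _ k.succ_pos)
        (hf (k + 1) (by omega) (by omega)) (hle.trans hfm.le)
        fun j hj => hle.trans (hmin' j (by omega))).trans hle
  exact ((hdown a le_rfl ham).trans_lt hfm).not_ge ha

theorem IsSingleDeathRate.eq_zero_of_isHarmonicAt (hq : IsSingleDeathRate q) {N : ℕ}
    (hN : ∀ j, N ≤ j → f j = 0) (hf : ∀ i, 1 ≤ i → i ≤ N → IsHarmonicAt q ω f i) (i : ℕ) :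
    f i = 0 := by
  induction i using Nat.strong_decreasing_induction with
  | base => exact ⟨N, fun j hj => hN j hj.le⟩
  | step k ih =>
    rcases le_or_gt N k with hNk | hkN
    · exact hN k hNk
    have hzero := hf (k + 1) k.succ_pos hkN
    rw [IsHarmonicAt, ih (k + 1) k.lt_succ_self, mul_zero] at hzero
    have hsingle : HasSum (fun j => q (k + 1) j * f j) (q (k + 1) k * f k) :=
      hasSum_single k fun j hj => by
        rcases lt_or_gt_of_ne hj with h | h
        · rw [hq.skip_free (k + 1) j (by omega), zero_mul]
        · rw [ih j h, mul_zero]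
    exact (mul_eq_zero.mp (hsingle.unique hzero)).resolve_left (hq.down_pos (k + 1) k.succ_pos).ne'

end Harmonic

/-! ### The limit `Z^{(ω)}(i, ∞)` -/

section Resolvent

variable {q : ℕ → ℕ → ℝ} {ω : ℕ → ℝ}

theorem IsSingleDeathRate.W_eq_add_sum (hq : IsSingleDeathRate q) (ω ω' : ℕ → ℝ) (i N : ℕ) :
    W q ω i N = W q ω' i N +
      ∑ u ∈ Finset.range N, (ω u - ω' u) * W q ω' u N * W q ω i u := by
  set c : ℕ → ℝ := fun u => (ω u - ω' u) * W q ω' u N with hc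
  refine (sub_eq_zero.mp (hq.eq_zero_of_isHarmonicAt (ω := ω) (N := N) (f := fun i =>
    W q ω' i N + ∑ u ∈ Finset.range N, c u * W q ω i u - W q ω i N)
    (fun j hj => ?_) (fun i hi hiN => ?_) i)).symm
  · rw [W_eq_zero q ω hj, W_eq_zero q ω' hj, zero_add, sub_zero]
    exact Finset.sum_eq_zero fun u hu => by
      rw [W_eq_zero q ω ((Finset.mem_range.mp hu).le.trans hj), mul_zero]
  · have hci : (if i < N then c i else 0) = c i := by
      rcases hiN.eq_or_lt with rfl | hlt
      · simp [hc, W_eq_zero q ω' le_rfl]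
      · rw [if_pos hlt]
    have hsum := ((hq.hasSum_rate_mul_W ω' hi N).add
      (hq.hasSum_rate_mul_sum_W ω c (N := N) hi)).sub (hq.hasSum_rate_mul_W ω hi N)
    rw [hci, add_sub_add_comm] at hsum
    simp only [IsHarmonicAt, mul_sub, mul_add]
    refine (congrArg (HasSum _) ?_).mp hsum
    rw [hc]
    ring

theorem IsSingleDeathRate.W_le_mul_ZBar (hq : IsSingleDeathRate q) (hω : ∀ i, 1 ≤ i → 0 ≤ ω i)
    (i N : ℕ) : W q ω i N ≤ W q 0 0 N * ZBar q ω i N := by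
  have hle : ∀ u, W q 0 u N ≤ W q 0 0 N := fun u =>
    hq.W_antitone (fun _ _ => le_rfl) N u.zero_le
  rw [hq.W_eq_add_sum ω 0 i N, ZBar, mul_add, mul_one, Finset.mul_sum]
  refine add_le_add (hle i) (Finset.sum_le_sum fun u _ => ?_)
  calc (ω u - 0) * W q 0 u N * W q ω i u = W q 0 u N * (ω u * W q ω i u) := by ring
    _ ≤ W q 0 0 N * (ω u * W q ω i u) :=
      mul_le_mul_of_nonneg_right (hle u) (hq.weight_mul_W_nonneg hω hω i u)

/-- The discrete Grönwall inequality for `ZBar q ω i (N + 1) - ZBar q ω i N = ω N * W q ω i N`. -/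
theorem IsSingleDeathRate.ZBar_le_exp (hq : IsSingleDeathRate q) (hω : ∀ i, 1 ≤ i → 0 ≤ ω i)
    (i N : ℕ) : ZBar q ω i N ≤ Real.exp (∑ u ∈ Finset.range N, ω u * W q 0 0 u) := by
  induction N with
  | zero => simp [ZBar]
  | succ N ih =>
    have hnonneg := hq.weight_mul_W_nonneg hω (ω' := 0) (fun _ _ => le_rfl) 0 N
    have hstep : ω N * W q ω i N ≤ ω N * W q 0 0 N * ZBar q ω i N := by
      rcases Nat.eq_zero_or_pos N with rfl | hN
      · simp [W_eq_zero]
      · rw [mul_assoc]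
        exact mul_le_mul_of_nonneg_left (hq.W_le_mul_ZBar hω i N) (hω N hN)
    calc ZBar q ω i (N + 1) ≤ (ω N * W q 0 0 N + 1) * ZBar q ω i N := by
          rw [ZBar_succ]
          linarith
      _ ≤ Real.exp (ω N * W q 0 0 N) * Real.exp (∑ u ∈ Finset.range N, ω u * W q 0 0 u) :=
          mul_le_mul (Real.add_one_le_exp _) ih
            (zero_le_one.trans (hq.one_le_ZBar hω i N)) (Real.exp_pos _).le
      _ = Real.exp (∑ u ∈ Finset.range (N + 1), ω u * W q 0 0 u) := by
          rw [← Real.exp_add, Finset.sum_range_succ, add_comm]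

theorem IsSingleDeathRate.summable_weight_mul_W (hq : IsSingleDeathRate q)
    (hω : ∀ i, 1 ≤ i → 0 ≤ ω i) (hs : Summable fun u => ω u * W q 0 0 u) (i : ℕ) :
    Summable fun u => ω u * W q ω i u := by
  refine summable_of_sum_range_le (c := Real.exp (∑' u, ω u * W q 0 0 u))
    (hq.weight_mul_W_nonneg hω hω i) fun N => ?_
  calc ∑ u ∈ Finset.range N, ω u * W q ω i u
      ≤ ZBar q ω i N := le_add_of_nonneg_left zero_le_one
    _ ≤ Real.exp (∑ u ∈ Finset.range N, ω u * W q 0 0 u) := hq.ZBar_le_exp hω i N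
    _ ≤ Real.exp (∑' u, ω u * W q 0 0 u) := Real.exp_le_exp.mpr
      (hs.sum_le_tsum _ fun u _ => hq.weight_mul_W_nonneg hω (fun _ _ => le_rfl) 0 u)

theorem tendsto_Z_ZInf {i : ℕ} (hs : Summable fun u => ω u * W q ω i u) :
    Tendsto (fun N => Z q ω i N) atTop (𝓝 (ZInf q ω i)) := by
  have hZInf : ZInf q ω i = 1 + ∑' u, ω u * W q ω i u := by
    rw [ZInf, ← hs.sum_add_tsum_nat_add (i + 1), Finset.sum_eq_zero fun u hu => by
      rw [W_eq_zero q ω (Nat.lt_succ_iff.mp (Finset.mem_range.mp hu)), mul_zero], zero_add]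
    simp_rw [add_comm (i + 1)]
  rw [hZInf]
  refine (hs.hasSum.tendsto_sum_nat.const_add 1).congr' ?_
  filter_upwards [eventually_gt_atTop i] with N hN
  rw [Z_eq_ZBar q ω hN, ZBar]

theorem IsSingleDeathRate.one_le_ZInf (hq : IsSingleDeathRate q) (hω : ∀ i, 1 ≤ i → 0 ≤ ω i)
    (i : ℕ) : 1 ≤ ZInf q ω i :=
  le_add_of_nonneg_right (tsum_nonneg fun _ => hq.weight_mul_W_nonneg hω hω i _)

end Resolvent

/-! ### Potentials of non-negative kernels -/

section Kernel

variable {ι : Type*}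

/-- The action `M h` of a non-negative kernel `M` on a non-negative function `h`. -/
def applyKernel (M : ι → ι → ℝ≥0∞) (h : ι → ℝ≥0∞) (i : ι) : ℝ≥0∞ := ∑' j, M i j * h j

/-- The potential `∑ₙ Mⁿ g` of a non-negative function `g` under the kernel `M`. -/
def potential (M : ι → ι → ℝ≥0∞) (g : ι → ℝ≥0∞) (i : ι) : ℝ≥0∞ := ∑' n, (applyKernel M)^[n] g i

theorem applyKernel_mono (M : ι → ι → ℝ≥0∞) : Monotone (applyKernel M) :=
  fun _ _ h i => ENNReal.tsum_le_tsum fun j => mul_le_mul_right (h j) (M i j)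

theorem potential_eq (M : ι → ι → ℝ≥0∞) (g : ι → ℝ≥0∞) (i : ι) :
    potential M g i = g i + applyKernel M (potential M g) i := by
  rw [potential, tsum_eq_zero_add' ENNReal.summable]
  simp_rw [applyKernel, potential, ← ENNReal.tsum_mul_left, Function.iterate_succ_apply']
  rw [ENNReal.tsum_comm]
  rfl

theorem potential_le_of_add_applyKernel_le {M : ι → ι → ℝ≥0∞} {g h : ι → ℝ≥0∞}
    (hle : ∀ i, g i + applyKernel M h i ≤ h i) (i : ι) : potential M g i ≤ h i := by
  rw [potential, ENNReal.tsum_eq_iSup_nat]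
  refine iSup_le fun m => ?_
  induction m generalizing i with
  | zero => simp
  | succ m ih =>
    have hsucc : ∑ n ∈ Finset.range m, (applyKernel M)^[n + 1] g i =
        applyKernel M (fun j => ∑ n ∈ Finset.range m, (applyKernel M)^[n] g j) i := by
      simp_rw [Function.iterate_succ_apply', applyKernel, Finset.mul_sum]
      exact (Summable.tsum_finsetSum fun _ _ => ENNReal.summable).symm
    rw [Finset.sum_range_succ', hsucc, add_comm]
    exact (add_le_add_right (applyKernel_mono M ih i) _).trans (hle i)

theorem applyKernel_liminf_le [Countable ι] (M : ι → ι → ℝ≥0∞) (h : ℕ → ι → ℝ≥0∞) (i : ι) :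
    applyKernel M (fun j => liminf (fun N => h N j) atTop) i ≤
      liminf (fun N => applyKernel M (h N) i) atTop := by
  let _ : MeasurableSpace ι := ⊤
  calc applyKernel M (fun j => liminf (fun N => h N j) atTop) i
      ≤ ∑' j, liminf (fun N => M i j * h N j) atTop := ENNReal.tsum_le_tsum fun j => by
        refine le_trans ?_ ENNReal.le_liminf_mul
        rw [liminf_const]
    _ ≤ liminf (fun N => applyKernel M (h N) i) atTop := by
        simp_rw [applyKernel, ← lintegral_count]
        exact lintegral_liminf_le fun N => measurable_of_countable _

end Kernel

/-! ### Discounted hitting probabilities -/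

section HitProb

variable {q : ℕ → ℕ → ℝ} {ω : ℕ → ℝ} {a i : ℕ}

/-- `q_i / (q_i + ω_i)`, the Laplace transform at `ω_i` of the holding time at `i`. -/
def discount (q : ℕ → ℕ → ℝ) (ω : ℕ → ℝ) (i : ℕ) : ℝ≥0∞ :=
  ENNReal.ofReal (exitRate q i / (exitRate q i + ω i))

/-- The kernel of the jump chain discounted by `discount q ω` and killed in `[0, a]`. -/
def killedKernel (q : ℕ → ℕ → ℝ) (ω : ℕ → ℝ) (a i j : ℕ) : ℝ≥0∞ :=
  if a < i then discount q ω i * ENNReal.ofReal (jumpProb q i j) else 0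

/-- The discounted probability that the jump chain started at `i` reaches `a` from above, as a sum
over the number of jumps needed. -/
def hitProb (q : ℕ → ℕ → ℝ) (ω : ℕ → ℝ) (a : ℕ) : ℕ → ℝ≥0∞ :=
  potential (killedKernel q ω a) (Pi.single a 1)

theorem applyKernel_killedKernel_of_le (q : ℕ → ℕ → ℝ) (ω : ℕ → ℝ) (h : ℕ → ℝ≥0∞)
    (hi : i ≤ a) : applyKernel (killedKernel q ω a) h i = 0 := by
  simp [applyKernel, killedKernel, hi.not_gt]

theorem applyKernel_killedKernel_of_lt (q : ℕ → ℕ → ℝ) (ω : ℕ → ℝ) (h : ℕ → ℝ≥0∞)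
    (hi : a < i) : applyKernel (killedKernel q ω a) h i =
      discount q ω i * ∑' j, ENNReal.ofReal (jumpProb q i j) * h j := by
  simp only [applyKernel, killedKernel, if_pos hi, mul_assoc, ENNReal.tsum_mul_left]

theorem hitProb_self (q : ℕ → ℕ → ℝ) (ω : ℕ → ℝ) (a : ℕ) : hitProb q ω a a = 1 := by
  rw [hitProb, potential_eq, applyKernel_killedKernel_of_le q ω _ le_rfl, Pi.single_eq_same,
    add_zero]

theorem hitProb_le {h : ℕ → ℝ≥0∞} (ha : 1 ≤ h a)
    (hh : ∀ i, a < i → applyKernel (killedKernel q ω a) h i ≤ h i) (i : ℕ) :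
    hitProb q ω a i ≤ h i := by
  refine potential_le_of_add_applyKernel_le (fun i => ?_) i
  rcases lt_trichotomy i a with hi | rfl | hi
  · simp [applyKernel_killedKernel_of_le q ω h hi.le, Pi.single_eq_of_ne hi.ne]
  · simpa [applyKernel_killedKernel_of_le q ω h le_rfl] using ha
  · simpa [Pi.single_eq_of_ne hi.ne'] using hh i hi

theorem IsSingleDeathRate.hitProb_le_one (hq : IsSingleDeathRate q) (hω : ∀ i, 1 ≤ i → 0 ≤ ω i)
    (a i : ℕ) : hitProb q ω a i ≤ 1 := by
  refine hitProb_le (h := fun _ => 1) le_rfl (fun i hi => ?_) i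
  simp_rw [applyKernel_killedKernel_of_lt q ω _ hi, mul_one, hq.tsum_ofReal_jumpProb, mul_one]
  have hpos := hq.exitRate_pos (Nat.one_le_of_lt hi)
  have hωi := hω i (Nat.one_le_of_lt hi)
  exact ENNReal.ofReal_le_one.mpr (div_le_one_of_le₀ (by linarith) (by positivity))

theorem IsSingleDeathRate.applyKernel_ofReal_eq_iff (hq : IsSingleDeathRate q)
    (hω : ∀ i, 1 ≤ i → 0 ≤ ω i) {f : ℕ → ℝ} (hf : ∀ j, 0 ≤ f j) (hi : a < i) :
    applyKernel (killedKernel q ω a) (fun j => ENNReal.ofReal (f j)) i = ENNReal.ofReal (f i) ↔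
      IsHarmonicAt q ω f i := by
  have hi1 : 1 ≤ i := Nat.one_le_of_lt hi
  have hpos := hq.exitRate_pos hi1
  have hωi := hω i hi1
  have hfi := hf i
  set s := f i + ω i * f i / exitRate q i with hs
  have hsnonneg : 0 ≤ s := by positivity
  have hscale : ENNReal.ofReal (f i) = discount q ω i * ENNReal.ofReal s := by
    rw [discount, ← ENNReal.ofReal_mul (by positivity), hs]
    congr 1
    field_simp
  have hdisc : discount q ω i ≠ 0 :=
    (ENNReal.ofReal_pos.mpr (div_pos hpos (by linarith))).ne'
  rw [IsHarmonicAt, hq.hasSum_rate_mul_iff hi1, hasSum_iff_tsum_ofReal_eq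
    (fun j => mul_nonneg (hq.jumpProb_nonneg i j) (hf j)) hsnonneg,
    applyKernel_killedKernel_of_lt q ω _ hi, hscale,
    ENNReal.mul_right_inj hdisc ENNReal.ofReal_ne_top]
  simp_rw [ENNReal.ofReal_mul (hq.jumpProb_nonneg i _)]

theorem IsSingleDeathRate.isHarmonicAt_hitProb (hq : IsSingleDeathRate q)
    (hω : ∀ i, 1 ≤ i → 0 ≤ ω i) (hi : a < i) :
    IsHarmonicAt q ω (fun j => (hitProb q ω a j).toReal) i := by
  have hfin : ∀ j, ENNReal.ofReal (hitProb q ω a j).toReal = hitProb q ω a j := fun j =>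
    ENNReal.ofReal_toReal ((hq.hitProb_le_one hω a j).trans_lt ENNReal.one_lt_top).ne
  rw [← hq.applyKernel_ofReal_eq_iff hω (fun _ => ENNReal.toReal_nonneg) hi]
  simp_rw [hfin]
  conv_rhs => rw [hitProb, potential_eq, Pi.single_eq_of_ne hi.ne', zero_add]
  rfl

/-- The discounted probability that the process started at `i` reaches `a` before `[N, ∞)`. -/
def scaleRatio (q : ℕ → ℕ → ℝ) (ω : ℕ → ℝ) (a N i : ℕ) : ℝ := W q ω i N / W q ω a N

theorem IsSingleDeathRate.scaleRatio_nonneg (hq : IsSingleDeathRate q)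
    (hω : ∀ i, 1 ≤ i → 0 ≤ ω i) (a N i : ℕ) : 0 ≤ scaleRatio q ω a N i :=
  div_nonneg (hq.W_nonneg hω i N) (hq.W_nonneg hω a N)

theorem IsSingleDeathRate.scaleRatio_le_one (hq : IsSingleDeathRate q)
    (hω : ∀ i, 1 ≤ i → 0 ≤ ω i) (N : ℕ) (hi : a ≤ i) : scaleRatio q ω a N i ≤ 1 :=
  div_le_one_of_le₀ (hq.W_antitone hω N hi) (hq.W_nonneg hω a N)

theorem IsSingleDeathRate.scaleRatio_self (hq : IsSingleDeathRate q)
    (hω : ∀ i, 1 ≤ i → 0 ≤ ω i) {N : ℕ} (hN : a < N) : scaleRatio q ω a N a = 1 :=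
  div_self (hq.W_pos hω hN).ne'

theorem scaleRatio_eq_zero (q : ℕ → ℕ → ℝ) (ω : ℕ → ℝ) (a : ℕ) {N : ℕ} (hi : N ≤ i) :
    scaleRatio q ω a N i = 0 := by
  rw [scaleRatio, W_eq_zero q ω hi, zero_div]

theorem IsSingleDeathRate.isHarmonicAt_scaleRatio (hq : IsSingleDeathRate q) (ω : ℕ → ℝ)
    (a : ℕ) {N : ℕ} (hi : 1 ≤ i) (hN : i ≠ N) : IsHarmonicAt q ω (scaleRatio q ω a N) i :=
  (hq.isHarmonicAt_W ω hi hN).div_const _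

theorem IsSingleDeathRate.scaleRatio_le_hitProb (hq : IsSingleDeathRate q)
    (hω : ∀ i, 1 ≤ i → 0 ≤ ω i) {N : ℕ} (hN : a < N) (hi : a ≤ i) :
    scaleRatio q ω a N i ≤ (hitProb q ω a i).toReal := by
  refine sub_nonneg.mp (hq.nonneg_of_isSuperharmonicAt hω (N := N)
    (f := fun j => (hitProb q ω a j).toReal - scaleRatio q ω a N j) ?_ (fun j hj => ?_)
    (fun j haj hjN => ?_) hi)
  · rw [hitProb_self, hq.scaleRatio_self hω hN, ENNReal.toReal_one, sub_self]
  · rw [scaleRatio_eq_zero q ω a hj, sub_zero]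
    exact ENNReal.toReal_nonneg
  · exact ((hq.isHarmonicAt_hitProb hω haj).sub
      (hq.isHarmonicAt_scaleRatio ω a (by omega) hjN.ne)).isSuperharmonicAt

theorem IsSingleDeathRate.hitProb_le_liminf_scaleRatio (hq : IsSingleDeathRate q)
    (hω : ∀ i, 1 ≤ i → 0 ≤ ω i) (a i : ℕ) :
    hitProb q ω a i ≤ liminf (fun N => ENNReal.ofReal (scaleRatio q ω a N i)) atTop := by
  refine hitProb_le (h := fun i => liminf (fun N => ENNReal.ofReal (scaleRatio q ω a N i)) atTop)
    ?_ (fun i hi => ?_) i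
  · refine le_liminf_of_le (by isBoundedDefault) ?_
    filter_upwards [eventually_gt_atTop a] with N hN
    rw [hq.scaleRatio_self hω hN, ENNReal.ofReal_one]
  · refine (applyKernel_liminf_le _ (fun N j => ENNReal.ofReal (scaleRatio q ω a N j)) i).trans
      (liminf_congr ?_).le
    filter_upwards [eventually_gt_atTop i] with N hN
    exact (hq.applyKernel_ofReal_eq_iff hω (hq.scaleRatio_nonneg hω a N) hi).mpr
      (hq.isHarmonicAt_scaleRatio ω a (by omega) hN.ne)

theorem IsSingleDeathRate.tendsto_scaleRatio (hq : IsSingleDeathRate q)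
    (hω : ∀ i, 1 ≤ i → 0 ≤ ω i) (hi : a ≤ i) :
    Tendsto (fun N => scaleRatio q ω a N i) atTop (𝓝 (hitProb q ω a i).toReal) := by
  have hfin : hitProb q ω a i ≠ ⊤ := ((hq.hitProb_le_one hω a i).trans_lt ENNReal.one_lt_top).ne
  have hlim : Tendsto (fun N => ENNReal.ofReal (scaleRatio q ω a N i)) atTop
      (𝓝 (hitProb q ω a i)) := by
    refine tendsto_of_le_liminf_of_limsup_le (hq.hitProb_le_liminf_scaleRatio hω a i)
      (limsup_le_of_le (by isBoundedDefault) ?_)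
    filter_upwards [eventually_gt_atTop a] with N hN
    exact ENNReal.ofReal_le_of_le_toReal (hq.scaleRatio_le_hitProb hω hN hi)
  refine ((ENNReal.tendsto_toReal hfin).comp hlim).congr fun N => ?_
  exact ENNReal.toReal_ofReal (hq.scaleRatio_nonneg hω a N i)

theorem IsSingleDeathRate.scaleRatio_le_ZBar_div (hq : IsSingleDeathRate q)
    (hω : ∀ i, 1 ≤ i → 0 ≤ ω i) {N : ℕ} (hN : a < N) (hi : a ≤ i) :
    scaleRatio q ω a N i ≤ ZBar q ω i N / ZBar q ω a N := by
  have hZ := zero_lt_one.trans_le (hq.one_le_ZBar hω a N)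
  refine sub_nonneg.mp (hq.nonneg_of_isSuperharmonicAt hω (N := N)
    (f := fun j => ZBar q ω j N / ZBar q ω a N - scaleRatio q ω a N j) ?_ (fun j hj => ?_)
    (fun j haj hjN => ?_) hi)
  · rw [hq.scaleRatio_self hω hN, div_self hZ.ne', sub_self]
  · rw [scaleRatio_eq_zero q ω a hj, ZBar_eq_one q ω hj, sub_zero]
    positivity
  · exact (((hq.isHarmonicAt_ZBar ω (by omega) hjN).div_const _).sub
      (hq.isHarmonicAt_scaleRatio ω a (by omega) hjN.ne)).isSuperharmonicAt

/-- Probabilistically, the difference is a discounted probability of reaching `[N, ∞)` before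
`a`, and the right-hand side is the undiscounted one. -/
theorem IsSingleDeathRate.ZBar_div_sub_scaleRatio_le (hq : IsSingleDeathRate q)
    (hω : ∀ i, 1 ≤ i → 0 ≤ ω i) {N : ℕ} (hN : a < N) (hi : a ≤ i) :
    ZBar q ω i N / ZBar q ω a N - scaleRatio q ω a N i ≤ 1 - scaleRatio q 0 a N i := by
  have hω0 : ∀ i, 1 ≤ i → 0 ≤ (0 : ℕ → ℝ) i := fun _ _ => le_rfl
  have hZ := hq.one_le_ZBar hω a N
  refine sub_nonneg.mp (hq.nonneg_of_isSuperharmonicAt hω (N := N)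
    (f := fun j => 1 - scaleRatio q 0 a N j -
      (ZBar q ω j N / ZBar q ω a N - scaleRatio q ω a N j)) ?_ (fun j hj => ?_)
    (fun j haj hjN => ?_) hi)
  · simp [hq.scaleRatio_self hω hN, hq.scaleRatio_self hω0 hN, (zero_lt_one.trans_le hZ).ne']
  · simp only [scaleRatio_eq_zero q _ a hj, ZBar_eq_one q ω hj, sub_zero, sub_nonneg]
    exact div_le_one_of_le₀ hZ (by positivity)
  · have hj : 1 ≤ j := Nat.one_le_of_lt haj
    exact (hq.isSuperharmonicAt_one_sub (hq.isHarmonicAt_scaleRatio 0 a hj hjN.ne) (hω j hj)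
      (hq.scaleRatio_le_one hω0 N haj.le)).sub (((hq.isHarmonicAt_ZBar ω hj hjN).div_const _).sub
        (hq.isHarmonicAt_scaleRatio ω a hj hjN.ne))

theorem IsSingleDeathRate.tendsto_Z_div (hq : IsSingleDeathRate q) (hω : ∀ i, 1 ≤ i → 0 ≤ ω i)
    (hi : a ≤ i) (hrec : hitProb q 0 a i = 1) :
    Tendsto (fun N => Z q ω i N / Z q ω a N) atTop (𝓝 (hitProb q ω a i).toReal) := by
  have hescape := (hq.tendsto_scaleRatio (ω := 0) (fun _ _ => le_rfl) hi).const_sub 1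
  rw [hrec, ENNReal.toReal_one, sub_self] at hescape
  have hdiff : Tendsto (fun N => ZBar q ω i N / ZBar q ω a N - scaleRatio q ω a N i) atTop
      (𝓝 0) := by
    refine tendsto_of_tendsto_of_tendsto_of_le_of_le' tendsto_const_nhds hescape ?_ ?_ <;>
      filter_upwards [eventually_gt_atTop a] with N hN
    · exact sub_nonneg.mpr (hq.scaleRatio_le_ZBar_div hω hN hi)
    · exact hq.ZBar_div_sub_scaleRatio_le hω hN hi
  have hsum := (hq.tendsto_scaleRatio hω hi).add hdiff
  rw [add_zero] at hsum
  refine hsum.congr' ?_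
  filter_upwards [eventually_gt_atTop i] with N hN
  rw [Z_eq_ZBar q ω hN, Z_eq_ZBar q ω (hi.trans_lt hN), add_sub_cancel]

end HitProb

/-! ### Exponential holding times -/

theorem measurable_expNeg : Measurable expNeg :=
  Measurable.ite (measurableSet_singleton ⊤) measurable_const (by fun_prop)

theorem expNeg_nonneg (x : ℝ≥0∞) : 0 ≤ expNeg x := by
  unfold expNeg
  positivity

theorem expNeg_of_ne_top {x : ℝ≥0∞} (hx : x ≠ ⊤) : expNeg x = Real.exp (-x.toReal) := if_neg hx

theorem expNeg_zero : expNeg 0 = 1 := by simp [expNeg]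

theorem expNeg_add (x y : ℝ≥0∞) : expNeg (x + y) = expNeg x * expNeg y := by
  by_cases hx : x = ⊤
  · simp [expNeg, hx]
  by_cases hy : y = ⊤
  · simp [expNeg, hy]
  rw [expNeg_of_ne_top hx, expNeg_of_ne_top hy, expNeg_of_ne_top (ENNReal.add_ne_top.mpr ⟨hx, hy⟩),
    ENNReal.toReal_add hx hy, neg_add, Real.exp_add]

theorem expNeg_sum {κ : Type*} (s : Finset κ) (u : κ → ℝ≥0∞) :
    expNeg (∑ k ∈ s, u k) = ∏ k ∈ s, expNeg (u k) := by
  classical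
  induction s using Finset.induction_on with
  | empty => simp [expNeg_zero]
  | insert k s hk ih => rw [Finset.sum_insert hk, Finset.prod_insert hk, expNeg_add, ih]

/-- The law of a holding time of rate `l`: exponential if `0 < l`, and concentrated at `∞`
otherwise, since an absorbing state is never left. -/
def holdLaw (l : ℝ) : Measure ℝ≥0∞ :=
  if 0 < l then (ProbabilityTheory.expMeasure l).map ENNReal.ofReal else Measure.dirac ⊤

instance isProbabilityMeasure_holdLaw (l : ℝ) : IsProbabilityMeasure (holdLaw l) := by
  unfold holdLaw
  split_ifs with hl
  · have := ProbabilityTheory.isProbabilityMeasure_expMeasure hl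
    exact Measure.isProbabilityMeasure_map ENNReal.measurable_ofReal.aemeasurable
  · infer_instance

theorem holdLaw_Ioi {l : ℝ} (hl : 0 ≤ l) (t : ℝ≥0) :
    holdLaw l (Set.Ioi (t : ℝ≥0∞)) = ENNReal.ofReal (Real.exp (-(l * t))) := by
  rcases hl.eq_or_lt with rfl | hl
  · simp [holdLaw]
  have := ProbabilityTheory.isProbabilityMeasure_expMeasure hl
  have hpre : ENNReal.ofReal ⁻¹' Set.Ioi (t : ℝ≥0∞) = (Set.Iic (t : ℝ))ᶜ := by
    ext x
    simp only [Set.mem_preimage, Set.mem_Ioi, Set.mem_compl_iff, Set.mem_Iic, not_le,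
      ENNReal.lt_ofReal_iff_toReal_lt ENNReal.coe_ne_top, ENNReal.coe_toReal]
  rw [holdLaw, if_pos hl, Measure.map_apply ENNReal.measurable_ofReal measurableSet_Ioi, hpre,
    prob_compl_eq_one_sub measurableSet_Iic, ← ProbabilityTheory.ofReal_cdf,
    ProbabilityTheory.cdf_expMeasure_eq hl, if_pos t.coe_nonneg, ← ENNReal.ofReal_one,
    ← ENNReal.ofReal_sub _ (sub_nonneg.mpr (Real.exp_le_one_iff.mpr
      (neg_nonpos.mpr (mul_nonneg hl.le t.coe_nonneg)))), sub_sub_cancel]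

theorem holdLaw_Ioi_zero {l : ℝ} (hl : 0 ≤ l) : holdLaw l (Set.Ioi 0) = 1 := by
  simpa only [ENNReal.coe_zero, NNReal.coe_zero, mul_zero, neg_zero, Real.exp_zero,
    ENNReal.ofReal_one] using holdLaw_Ioi hl 0

open ProbabilityTheory in
theorem exp_mul_exponentialPDF {l r : ℝ} (hl : 0 < l) (hr : 0 ≤ r) (x : ℝ) :
    exponentialPDF l x * ENNReal.ofReal (Real.exp (-(r * x))) =
      ENNReal.ofReal (l / (l + r)) * exponentialPDF (l + r) x := by
  rcases lt_or_ge x 0 with hx | hx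
  · simp only [exponentialPDF_of_neg hx, zero_mul, mul_zero]
  · have hlr : l + r ≠ 0 := by positivity
    rw [exponentialPDF_of_nonneg hx, exponentialPDF_of_nonneg hx,
      ← ENNReal.ofReal_mul (by positivity), ← ENNReal.ofReal_mul (by positivity), ← mul_assoc,
      div_mul_cancel₀ l hlr, mul_assoc, ← Real.exp_add]
    ring_nf

/-- The discount `e^{-r s}` collected during a holding time `s`, and `0` if the holding time is
infinite, so that paths absorbed in a state do not contribute. -/
def holdDiscount (r : ℝ) (s : ℝ≥0∞) : ℝ≥0∞ :=
  if s = ⊤ then 0 else ENNReal.ofReal (expNeg (ENNReal.ofReal r * s))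

theorem measurable_holdDiscount (r : ℝ) : Measurable (holdDiscount r) :=
  Measurable.ite (measurableSet_singleton ⊤) measurable_const
    (measurable_expNeg.comp (by fun_prop)).ennreal_ofReal

open ProbabilityTheory in
theorem lintegral_holdDiscount {l r : ℝ} (hl : 0 < l) (hr : 0 ≤ r) :
    ∫⁻ s, holdDiscount r s ∂holdLaw l = ENNReal.ofReal (l / (l + r)) := by
  have hdens : ∀ x : ℝ, exponentialPDF l x * holdDiscount r (ENNReal.ofReal x) =
      exponentialPDF l x * ENNReal.ofReal (Real.exp (-(r * x))) := by
    intro x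
    rcases lt_or_ge x 0 with hx | hx
    · simp only [exponentialPDF_of_neg hx, zero_mul]
    · rw [holdDiscount, if_neg ENNReal.ofReal_ne_top, ← ENNReal.ofReal_mul hr,
        expNeg_of_ne_top ENNReal.ofReal_ne_top, ENNReal.toReal_ofReal (mul_nonneg hr hx)]
  have hmeas : Measurable (exponentialPDF l) := (measurable_exponentialPDFReal l).ennreal_ofReal
  rw [holdLaw, if_pos hl, lintegral_map (measurable_holdDiscount r) ENNReal.measurable_ofReal]
  calc ∫⁻ x, holdDiscount r (ENNReal.ofReal x) ∂expMeasure l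
      = ∫⁻ x, exponentialPDF l x * holdDiscount r (ENNReal.ofReal x) :=
        lintegral_withDensity_eq_lintegral_mul _ hmeas
          ((measurable_holdDiscount r).comp ENNReal.measurable_ofReal)
    _ = ∫⁻ x, ENNReal.ofReal (l / (l + r)) * exponentialPDF (l + r) x := by
        simp_rw [hdens, exp_mul_exponentialPDF hl hr]
    _ = ENNReal.ofReal (l / (l + r)) := by
        rw [lintegral_const_mul' _ _ ENNReal.ofReal_ne_top,
          lintegral_exponentialPDF_eq_one (by positivity), mul_one]

theorem eq_empty_or_exists_measure_eq_Ioi {ρ : Measure ℝ≥0∞} (hρ : ∀ᵐ s ∂ρ, 0 < s) {s : Set ℝ≥0∞}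
    (hs : s ∈ insert Set.univ (Set.range Set.Ioi)) :
    s = ∅ ∨ ∃ t : ℝ≥0, ρ s = ρ (Set.Ioi (t : ℝ≥0∞)) ∧ ∀ x, 0 < x → (x ∈ s ↔ (t : ℝ≥0∞) < x) := by
  rcases hs with rfl | ⟨t, rfl⟩
  · exact Or.inr ⟨0, (measure_congr (eventuallyEq_univ.mpr hρ)).symm, fun x hx => by simpa using hx⟩
  · induction t with
    | top => exact Or.inl Set.Ioi_top
    | coe t => exact Or.inr ⟨t, rfl, fun x _ => Iff.rfl⟩

theorem generateFrom_pi_insert_univ_range_Ioi (κ : Type*) [Finite κ] :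
    MeasurableSpace.generateFrom (Set.univ.pi '' Set.univ.pi fun _ : κ =>
      insert Set.univ (Set.range (Set.Ioi : ℝ≥0∞ → Set ℝ≥0∞))) = MeasurableSpace.pi :=
  generateFrom_eq_pi
    (fun _ => by
      rw [MeasurableSpace.generateFrom_insert_univ, ← borel_eq_generateFrom_Ioi,
        ← BorelSpace.measurable_eq])
    fun _ => ⟨fun _ => Set.univ, fun _ => Set.mem_insert _ _, Set.iUnion_const _⟩

/-- The half-lines `(t, ∞]` do not cover `[0, ∞]`, so the whole space has to be added to them to
generate the product `σ`-algebra; positivity of the coordinates makes up for it. -/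
theorem map_eq_smul_pi_of_measure_Ioi {Ω κ : Type*} [MeasurableSpace Ω] [Fintype κ] {μ : Measure Ω}
    [IsFiniteMeasure μ] {X : κ → Ω → ℝ≥0∞} (hX : ∀ k, Measurable (X k)) {ρ : κ → Measure ℝ≥0∞}
    [∀ k, IsProbabilityMeasure (ρ k)] (hρ : ∀ k, ρ k (Set.Ioi 0) = 1)
    (h : ∀ t : κ → ℝ≥0, μ {w | ∀ k, (t k : ℝ≥0∞) < X k w} =
      μ Set.univ * ∏ k, ρ k (Set.Ioi (t k : ℝ≥0∞))) :
    μ.map (fun w k => X k w) = μ Set.univ • Measure.pi ρ := by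
  have hmX : Measurable fun w k => X k w := measurable_pi_lambda _ hX
  have hXpos : ∀ᵐ w ∂μ, ∀ k, 0 < X k w := by
    refine (ae_iff_measure_eq (MeasurableSet.nullMeasurableSet ?_)).mpr (by simpa [hρ] using h 0)
    simp only [Set.ofPred_forall]
    exact MeasurableSet.iInter fun k => measurableSet_lt measurable_const (hX k)
  have hρpos : ∀ k, ∀ᵐ s ∂ρ k, 0 < s := fun k =>
    (mem_ae_iff_prob_eq_one measurableSet_Ioi).mpr (hρ k)
  have hbox : ∀ s : κ → Set ℝ≥0∞, (∀ k, s k ∈ insert Set.univ (Set.range Set.Ioi)) →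
      μ.map (fun w k => X k w) (Set.univ.pi s) = (μ Set.univ • Measure.pi ρ) (Set.univ.pi s) := by
    intro s hs
    by_cases hempty : ∃ k, s k = ∅
    · rw [Set.univ_pi_eq_empty_iff.mpr hempty, measure_empty, measure_empty]
    choose t hρt hXt using fun k =>
      (eq_empty_or_exists_measure_eq_Ioi (hρpos k) (hs k)).resolve_left fun h => hempty ⟨k, h⟩
    have hms : ∀ k, MeasurableSet (s k) := fun k => by
      rcases hs k with h | ⟨t, h⟩
      · exact h ▸ MeasurableSet.univ
      · exact h ▸ measurableSet_Ioi
    rw [Measure.map_apply hmX (MeasurableSet.univ_pi hms), Measure.smul_apply, Measure.pi_pi,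
      smul_eq_mul, Finset.prod_congr rfl fun k _ => hρt k, ← h]
    refine measure_congr ?_
    filter_upwards [hXpos] with w hw
    exact propext (Set.mem_univ_pi.trans (forall_congr' fun k => hXt k _ (hw k)))
  refine ext_of_generate_finite _ (generateFrom_pi_insert_univ_range_Ioi κ).symm
    (IsPiSystem.pi fun _ => isPiSystem_Ioi.insert_univ) ?_ ?_
  · rintro _ ⟨s, hs, rfl⟩
    exact hbox s fun k => hs k (Set.mem_univ k)
  · simpa only [Set.pi_univ] using hbox (fun _ => Set.univ) fun _ => Set.mem_insert _ _

/-! ### The law of the jump chain -/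

section PathWeight

variable {ι : Type*} [DecidableEq ι]

/-- The weight which the transition kernel `M` gives to the path `x 0, …, x n` started at `i`. -/
def pathWeight (M : ι → ι → ℝ≥0∞) (i : ι) {n : ℕ} (x : Fin (n + 1) → ι) : ℝ≥0∞ :=
  (Pi.single i 1 : ι → ℝ≥0∞) (x 0) * ∏ k : Fin n, M (x k.castSucc) (x k.succ)

theorem pathWeight_cons (M : ι → ι → ℝ≥0∞) (i y : ι) {n : ℕ} (x : Fin (n + 1) → ι) :
    pathWeight M i (Fin.cons y x : Fin (n + 2) → ι) =
      (Pi.single i 1 : ι → ℝ≥0∞) y * ∑' j, M y j * pathWeight M j x := by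
  rw [tsum_eq_single (x 0) fun j hj => by simp [pathWeight, hj.symm]]
  simp [pathWeight, Fin.prod_univ_succ]

theorem tsum_pathWeight_mul (M : ι → ι → ℝ≥0∞) (g : ι → ℝ≥0∞) (n : ℕ) (i : ι) :
    ∑' x : Fin (n + 1) → ι, pathWeight M i x * g (x (Fin.last n)) = (applyKernel M)^[n] g i := by
  induction n generalizing i with
  | zero =>
    rw [tsum_eq_single fun _ => i]
    · simp [pathWeight]
    · intro x hx
      have : x 0 ≠ i := fun h => hx (funext fun k => by rw [Fin.fin_one_eq_zero k, h])
      simp [pathWeight, this]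
  | succ n ih =>
    calc ∑' x : Fin (n + 2) → ι, pathWeight M i x * g (x (Fin.last (n + 1)))
        = ∑' y, ∑' x : Fin (n + 1) → ι,
            pathWeight M i (Fin.cons y x : Fin (n + 2) → ι) * g (x (Fin.last n)) := by
          rw [← (Fin.consEquiv fun _ => ι).tsum_eq, ← ENNReal.tsum_prod]
          rfl
      _ = ∑' x : Fin (n + 1) → ι, ∑' j, M i j * (pathWeight M j x * g (x (Fin.last n))) := by
          rw [tsum_eq_single i fun y hy => by simp [pathWeight_cons, hy]]
          simp only [pathWeight_cons, Pi.single_eq_same, one_mul, ← ENNReal.tsum_mul_right,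
            mul_assoc]
      _ = (applyKernel M)^[n + 1] g i := by
          rw [ENNReal.tsum_comm, Function.iterate_succ_apply', applyKernel]
          simp_rw [ENNReal.tsum_mul_left, ih]

end PathWeight

section History

variable {Ω : Type*} {J : ℕ → Ω → ℕ} {S : ℕ → Ω → ℝ≥0∞}

/-- The event that the first `n + 1` visited states are `x 0, …, x n` and are held for positive
times. -/
def history (J : ℕ → Ω → ℕ) (S : ℕ → Ω → ℝ≥0∞) {n : ℕ} (x : Fin (n + 1) → ℕ) : Set Ω :=
  {w | ∀ k : Fin (n + 1), J k w = x k ∧ 0 < S k w}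

theorem disjoint_history {n : ℕ} {x y : Fin (n + 1) → ℕ} (hxy : x ≠ y) :
    Disjoint (history J S x) (history J S y) :=
  Set.disjoint_left.mpr fun _ hx hy => hxy (funext fun k => (hx k).1.symm.trans (hy k).1)

end History

section Chain

variable {q : ℕ → ℕ → ℝ} {ω : ℕ → ℝ} {Ω : Type*} [MeasurableSpace Ω] {P : ℕ → Measure Ω}
  {J : ℕ → Ω → ℕ} {S : ℕ → Ω → ℝ≥0∞} {a i : ℕ}

/-- The transition kernel of the embedded jump chain, with values in `[0, ∞]`. -/
def jumpKernel (q : ℕ → ℕ → ℝ) (i j : ℕ) : ℝ≥0∞ := ENNReal.ofReal (jumpProb q i j)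

theorem IsSingleDeathRate.iterate_applyKernel_jumpKernel (hq : IsSingleDeathRate q) (n i : ℕ) :
    (applyKernel (jumpKernel q))^[n] 1 i = 1 := by
  have hfix : applyKernel (jumpKernel q) 1 = 1 := funext fun i => by
    simp only [applyKernel, jumpKernel, Pi.one_apply, mul_one, hq.tsum_ofReal_jumpProb]
  rw [Function.iterate_fixed hfix, Pi.one_apply]

theorem pathWeight_killedKernel (q : ℕ → ℕ → ℝ) (ω : ℕ → ℝ) (a i : ℕ) {n : ℕ}
    (x : Fin (n + 1) → ℕ) : pathWeight (killedKernel q ω a) i x = pathWeight (jumpKernel q) i x *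
      ∏ k : Fin n, if a < x k.castSucc then discount q ω (x k.castSucc) else 0 := by
  simp only [pathWeight, mul_assoc, ← Finset.prod_mul_distrib]
  congr 1
  refine Finset.prod_congr rfl fun k _ => ?_
  rw [killedKernel, jumpKernel]
  split_ifs
  · exact mul_comm _ _
  · rw [mul_zero]

theorem IsMinimalChain.measurableSet_history (hc : IsMinimalChain q P J S) {n : ℕ}
    (x : Fin (n + 1) → ℕ) : MeasurableSet (history J S x) := by
  simp only [history, Set.ofPred_forall]
  exact MeasurableSet.iInter fun k => (hc.measurable_state k (measurableSet_singleton (x k))).inter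
    (measurableSet_lt measurable_const (hc.measurable_hold k))

theorem IsMinimalChain.measure_forall_fin (hc : IsMinimalChain q P J S)
    (hq : IsSingleDeathRate q) (i : ℕ) {n : ℕ} (x : Fin (n + 1) → ℕ) (t : Fin (n + 1) → ℝ≥0) :
    P i {w | ∀ k : Fin (n + 1), J k w = x k ∧ (t k : ℝ≥0∞) < S k w} =
      pathWeight (jumpKernel q) i x *
        ∏ k, holdLaw (exitRate q (x k)) (Set.Ioi (t k : ℝ≥0∞)) := by
  obtain ⟨x, rfl⟩ : ∃ x' : ℕ → ℕ, (fun k : Fin (n + 1) => x' k) = x :=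
    ⟨fun k => x (Fin.ofNat (n + 1) k), by simp⟩
  obtain ⟨t, rfl⟩ : ∃ t' : ℕ → ℝ≥0, (fun k : Fin (n + 1) => t' k) = t :=
    ⟨fun k => t (Fin.ofNat (n + 1) k), by simp⟩
  have hjump : ∀ k ∈ Finset.range n, 0 ≤ jumpProb q (x k) (x (k + 1)) :=
    fun k _ => hq.jumpProb_nonneg _ _
  have hlaw := hc.law i n x t
  rw [mul_assoc, ENNReal.ofReal_mul (by positivity),
    ENNReal.ofReal_mul (Finset.prod_nonneg hjump), ENNReal.ofReal_prod_of_nonneg hjump,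
    ENNReal.ofReal_prod_of_nonneg fun _ _ => (Real.exp_pos _).le, Finset.prod_range,
    Finset.prod_range] at hlaw
  simp only [← Nat.lt_succ_iff, Nat.succ_eq_add_one] at hlaw
  simp only [holdLaw_Ioi (hq.exitRate_nonneg _), pathWeight, mul_assoc, Fin.forall_iff]
  rw [hlaw]
  simp [Pi.single_apply, jumpKernel, apply_ite ENNReal.ofReal]

theorem IsMinimalChain.measure_history (hc : IsMinimalChain q P J S)
    (hq : IsSingleDeathRate q) (i : ℕ) {n : ℕ} (x : Fin (n + 1) → ℕ) :
    P i (history J S x) = pathWeight (jumpKernel q) i x := by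
  have h := hc.measure_forall_fin hq i x 0
  simp only [Pi.zero_apply, ENNReal.coe_zero, holdLaw_Ioi_zero (hq.exitRate_nonneg _),
    Finset.prod_const_one, mul_one] at h
  exact h

theorem IsMinimalChain.ae_mem_iUnion_history (hc : IsMinimalChain q P J S)
    (hq : IsSingleDeathRate q) (i n : ℕ) :
    ∀ᵐ w ∂P i, w ∈ ⋃ x : Fin (n + 1) → ℕ, history J S x := by
  have := hc.prob i
  refine (mem_ae_iff_prob_eq_one (.iUnion hc.measurableSet_history)).mpr ?_
  rw [measure_iUnion (fun _ _ => disjoint_history) hc.measurableSet_history]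
  simp_rw [hc.measure_history hq]
  simpa only [hq.iterate_applyKernel_jumpKernel, Pi.one_apply, mul_one] using
    tsum_pathWeight_mul (jumpKernel q) 1 n i

theorem IsMinimalChain.map_hold_restrict_history (hc : IsMinimalChain q P J S)
    (hq : IsSingleDeathRate q) (i : ℕ) {n : ℕ} (x : Fin (n + 1) → ℕ) :
    ((P i).restrict (history J S x)).map (fun w (k : Fin n) => S k w) =
      pathWeight (jumpKernel q) i x •
        Measure.pi fun k : Fin n => holdLaw (exitRate q (x k.castSucc)) := by
  have := hc.prob i
  have hmass : (P i).restrict (history J S x) Set.univ = pathWeight (jumpKernel q) i x := by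
    rw [Measure.restrict_apply_univ, hc.measure_history hq]
  rw [← hmass]
  refine map_eq_smul_pi_of_measure_Ioi (X := fun (k : Fin n) w => S k w)
    (fun k => hc.measurable_hold k) (fun k => ?_) fun t => ?_
  · exact holdLaw_Ioi_zero (hq.exitRate_nonneg _)
  · have h := hc.measure_forall_fin hq i x (Fin.snoc t 0 : Fin (n + 1) → ℝ≥0)
    rw [hmass, Measure.restrict_apply' (hc.measurableSet_history x)]
    have hset : {w | ∀ k : Fin n, (t k : ℝ≥0∞) < S k w} ∩ history J S x =
        {w | ∀ k : Fin (n + 1), J k w = x k ∧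
          ((Fin.snoc t 0 : Fin (n + 1) → ℝ≥0) k : ℝ≥0∞) < S k w} := by
      ext w
      simp only [history, Set.mem_inter_iff, Set.mem_ofPred_eq, Fin.forall_fin_succ',
        Fin.snoc_castSucc, Fin.snoc_last, ENNReal.coe_zero]
      exact ⟨fun ⟨ht, hx, hlast⟩ => ⟨fun k => ⟨(hx k).1, ht k⟩, hlast⟩,
        fun ⟨hx, hlast⟩ => ⟨fun k => (hx k).2,
          fun k => ⟨(hx k).1, pos_of_gt (hx k).2⟩, hlast⟩⟩
    rw [hset, h, Fin.prod_univ_castSucc]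
    simp only [Fin.snoc_castSucc, Fin.snoc_last, ENNReal.coe_zero,
      holdLaw_Ioi_zero (hq.exitRate_nonneg _), mul_one]

theorem IsMinimalChain.setLIntegral_history_prod (hc : IsMinimalChain q P J S)
    (hq : IsSingleDeathRate q) (i : ℕ) {n : ℕ} (x : Fin (n + 1) → ℕ)
    {φ : Fin n → ℝ≥0∞ → ℝ≥0∞} (hφ : ∀ k, Measurable (φ k)) :
    ∫⁻ w in history J S x, ∏ k : Fin n, φ k (S k w) ∂P i = pathWeight (jumpKernel q) i x *
      ∏ k : Fin n, ∫⁻ s, φ k s ∂holdLaw (exitRate q (x k.castSucc)) := by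
  have hφ' : ∀ k : Fin n, Measurable fun s : Fin n → ℝ≥0∞ => φ k (s k) :=
    fun k => (hφ k).comp (measurable_pi_apply k)
  rw [← lintegral_map (f := fun s : Fin n → ℝ≥0∞ => ∏ k, φ k (s k))
    (Finset.measurable_fun_prod _ fun k _ => hφ' k)
    (measurable_pi_lambda _ fun k : Fin n => hc.measurable_hold k),
    hc.map_hold_restrict_history hq, lintegral_smul_measure, smul_eq_mul,
    ProbabilityTheory.lintegral_prod_eq_prod_lintegral_of_indepFun _ _
      (ProbabilityTheory.iIndepFun_pi fun k => (hφ k).aemeasurable) hφ']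
  congr 1
  exact Finset.prod_congr rfl fun k _ => (measurePreserving_eval _ k).lintegral_comp (hφ k)

theorem IsMinimalChain.ae_exists_mem_history (hc : IsMinimalChain q P J S)
    (hq : IsSingleDeathRate q) (i : ℕ) : ∀ᵐ w ∂P i, ∀ n, ∃ x : Fin (n + 1) → ℕ,
      w ∈ history J S x ∧ pathWeight (jumpKernel q) i x ≠ 0 := by
  have hnull : ∀ᵐ w ∂P i, ∀ n, ∀ x : Fin (n + 1) → ℕ,
      pathWeight (jumpKernel q) i x = 0 → w ∉ history J S x :=
    ae_all_iff.mpr fun n => ae_all_iff.mpr fun x => Filter.eventually_imp_distrib_left.mpr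
      fun hx => measure_eq_zero_iff_ae_notMem.mp ((hc.measure_history hq i x).trans hx)
  filter_upwards [hnull, ae_all_iff.mpr (hc.ae_mem_iUnion_history hq i)] with w hw hmem n
  obtain ⟨x, hx⟩ := Set.mem_iUnion.mp (hmem n)
  exact ⟨x, hx, fun h => hw n x h hx⟩

theorem IsMinimalChain.ae_start_and_step (hc : IsMinimalChain q P J S)
    (hq : IsSingleDeathRate q) (i : ℕ) :
    ∀ᵐ w ∂P i, J 0 w = i ∧ ∀ k, 0 < S k w ∧ J k w ≤ J (k + 1) w + 1 := by
  filter_upwards [hc.ae_exists_mem_history hq i] with w hw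
  refine ⟨?_, fun k => ?_⟩
  · obtain ⟨x, hx, hpath⟩ := hw 0
    by_contra hi
    have h0 : x 0 ≠ i := fun h => hi ((hx 0).1.trans h)
    exact hpath (by simp [pathWeight, h0])
  · obtain ⟨x, hx, hpath⟩ := hw (k + 1)
    refine ⟨(hx (Fin.last k).castSucc).2, ?_⟩
    have hstep := Finset.prod_ne_zero_iff.mp (right_ne_zero_of_mul hpath) (Fin.last k)
      (Finset.mem_univ _)
    by_contra! hlt
    have hstate : J k w = x (Fin.last k).castSucc ∧ J (k + 1) w = x (Fin.last k).succ :=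
      ⟨(hx (Fin.last k).castSucc).1, (hx (Fin.last k).succ).1⟩
    rw [hstate.1, hstate.2] at hlt
    exact hstep (by rw [jumpKernel, hq.jumpProb_eq_zero (by omega), ENNReal.ofReal_zero])

end Chain

/-! ### First passage of a path -/

section Path

variable {x : ℕ → ℕ} {s : ℕ → ℝ≥0∞} {t : ℝ≥0} {a k : ℕ}

theorem jumpTime_succ (s : ℕ → ℝ≥0∞) (n : ℕ) : jumpTime s (n + 1) = jumpTime s n + s n :=
  Finset.sum_range_succ _ _

theorem jumpTime_mono (s : ℕ → ℝ≥0∞) : Monotone (jumpTime s) :=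
  monotone_nat_of_le_succ fun n => by rw [jumpTime_succ]; exact le_self_add

theorem le_of_jumpTime_le_of_lt {t : ℝ≥0∞} {l : ℕ} (hk : jumpTime s k ≤ t)
    (hl : t < jumpTime s (l + 1)) : k ≤ l :=
  Nat.lt_succ_iff.mp ((jumpTime_mono s).reflect_lt (hk.trans_lt hl))

theorem path_eq_some (hk : jumpTime s k ≤ t) (hk' : (t : ℝ≥0∞) < jumpTime s (k + 1)) :
    path x s t = some (x k) := by
  classical
  have hex : ∃ n, jumpTime s n ≤ (t : ℝ≥0∞) ∧ (t : ℝ≥0∞) < jumpTime s (n + 1) := ⟨k, hk, hk'⟩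
  obtain ⟨hle, hlt⟩ := Nat.find_spec hex
  rw [path, dif_pos hex,
    (le_of_jumpTime_le_of_lt hle hk').antisymm (le_of_jumpTime_le_of_lt hk hlt)]

theorem exists_jumpTime_le_of_path_eq_some (h : path x s t = some a) :
    ∃ k, jumpTime s k ≤ t ∧ x k = a := by
  classical
  rw [path] at h
  split_ifs at h with hex
  exact ⟨Nat.find hex, (Nat.find_spec hex).1, Option.some_inj.mp h⟩

theorem exists_first_eq {m : ℕ} (h0 : a ≤ x 0) (hm : x m ≤ a)
    (hstep : ∀ k, x k ≤ x (k + 1) + 1) : ∃ n ≤ m, x n = a ∧ ∀ k < n, a < x k := by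
  classical
  have hex : ∃ n, x n ≤ a := ⟨m, hm⟩
  have habove : ∀ k < Nat.find hex, a < x k := fun k hk => not_le.mp (Nat.find_min hex hk)
  refine ⟨Nat.find hex, Nat.find_min' hex hm, (Nat.find_spec hex).antisymm ?_, habove⟩
  rcases hn : Nat.find hex with _ | n
  · exact h0
  · have := habove n (by omega)
    have := hstep n
    omega

theorem setOf_ofReal_lt_eq_Ico {c : ℝ≥0∞} (hc : c ≠ ⊤) :
    {t : ℝ | 0 ≤ t ∧ ENNReal.ofReal t < c} = Set.Ico 0 c.toReal :=
  Set.ext fun _ => and_congr_right fun ht => ENNReal.ofReal_lt_iff_lt_toReal ht hc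

theorem setLIntegral_path (f : Option ℕ → ℝ≥0∞) {n : ℕ} (hfin : jumpTime s n < ⊤) :
    ∫⁻ t in {t : ℝ | 0 ≤ t ∧ ENNReal.ofReal t < jumpTime s n}, f (path x s t.toNNReal) =
      ∑ k ∈ Finset.range n, f (some (x k)) * s k := by
  induction n with
  | zero => simp [jumpTime]
  | succ n ih =>
    have hle : jumpTime s n ≤ jumpTime s (n + 1) := jumpTime_mono s n.le_succ
    have hfin' : jumpTime s n < ⊤ := hle.trans_lt hfin
    have hpath : ∀ t ∈ Set.Ico (jumpTime s n).toReal (jumpTime s (n + 1)).toReal,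
        f (path x s t.toNNReal) = f (some (x n)) := fun t ⟨hnt, htn⟩ => by
      have ht := ENNReal.toReal_nonneg.trans hnt
      rw [path_eq_some ((ENNReal.le_ofReal_iff_toReal_le hfin'.ne ht).mpr hnt)
        ((ENNReal.ofReal_lt_iff_lt_toReal ht hfin.ne).mpr htn)]
    have hlength : volume (Set.Ico (jumpTime s n).toReal (jumpTime s (n + 1)).toReal) = s n := by
      rw [Real.volume_Ico, ENNReal.ofReal_sub _ ENNReal.toReal_nonneg,
        ENNReal.ofReal_toReal hfin.ne, ENNReal.ofReal_toReal hfin'.ne, jumpTime_succ,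
        ENNReal.add_sub_cancel_left hfin'.ne]
    rw [setOf_ofReal_lt_eq_Ico hfin.ne, ← Set.Ico_union_Ico_eq_Ico ENNReal.toReal_nonneg
      (ENNReal.toReal_mono hfin.ne hle), lintegral_union measurableSet_Ico
      Set.Ico_disjoint_Ico_same, ← setOf_ofReal_lt_eq_Ico hfin'.ne, ih hfin',
      setLIntegral_congr_fun measurableSet_Ico hpath, setLIntegral_const, hlength,
      Finset.sum_range_succ]

end Path

section FirstPassage

variable {Ω : Type*} {J : ℕ → Ω → ℕ} {S : ℕ → Ω → ℝ≥0∞} {ω : ℕ → ℝ} {a n : ℕ} {w : Ω}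

/-- The path of `w` reaches the state `a` from above at its `n`-th jump, in finite time. -/
structure IsFirstPassage (J : ℕ → Ω → ℕ) (S : ℕ → Ω → ℝ≥0∞) (a n : ℕ) (w : Ω) : Prop where
  state_eq : J n w = a
  lt_state : ∀ k < n, a < J k w
  hold_ne_top : ∀ k < n, S k w ≠ ⊤

theorem IsFirstPassage.jumpTime_lt_top (h : IsFirstPassage J S a n w) :
    jumpTime (fun k => S k w) n < ⊤ :=
  ENNReal.sum_lt_top.mpr fun k hk => (h.hold_ne_top k (Finset.mem_range.mp hk)).lt_top

theorem IsFirstPassage.hittingTime_eq (h : IsFirstPassage J S a n w) (hpos : 0 < S n w) :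
    hittingTime (process J S) a w = jumpTime (fun k => S k w) n := by
  have hcoe := ENNReal.coe_toNNReal h.jumpTime_lt_top.ne
  refine le_antisymm (sInf_le ⟨(jumpTime (fun k => S k w) n).toNNReal, ?_, hcoe⟩) (le_sInf ?_)
  · rw [Set.mem_ofPred_eq, ← h.state_eq]
    refine path_eq_some (x := fun k => J k w) hcoe.ge ?_
    rw [hcoe, jumpTime_succ]
    exact ENNReal.lt_add_right h.jumpTime_lt_top.ne hpos.ne'
  · rintro _ ⟨t, ht, rfl⟩
    obtain ⟨k, hk, hstate⟩ := exists_jumpTime_le_of_path_eq_some ht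
    refine le_trans (jumpTime_mono _ ?_) hk
    by_contra! hkn
    exact (h.lt_state k hkn).ne' hstate

theorem exists_isFirstPassage_of_hittingTime_lt_top {b : ℕ} (hba : b ≤ a) (h0 : a ≤ J 0 w)
    (hstep : ∀ k, J k w ≤ J (k + 1) w + 1) (h : hittingTime (process J S) b w < ⊤) :
    ∃ n, IsFirstPassage J S a n w := by
  obtain ⟨_, ⟨t, ht, rfl⟩, -⟩ := sInf_lt_iff.mp h
  obtain ⟨m, hmt, hm⟩ := exists_jumpTime_le_of_path_eq_some ht
  obtain ⟨n, hnm, hn, habove⟩ :=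
    exists_first_eq (x := fun k => J k w) h0 (hm.le.trans hba) hstep
  have hfin : jumpTime (fun k => S k w) n < ⊤ :=
    ((jumpTime_mono _ hnm).trans hmt).trans_lt ENNReal.coe_lt_top
  exact ⟨n, hn, habove, fun k hk =>
    (ENNReal.sum_lt_top.mp hfin k (Finset.mem_range.mpr hk)).ne⟩

theorem IsFirstPassage.additive_eq (h : IsFirstPassage J S a n w) (hpos : 0 < S n w)
    (ω : ℕ → ℝ) : additive (process J S) ω a w =
      ∑ k ∈ Finset.range n, ENNReal.ofReal (ω (J k w)) * S k w := by
  rw [additive, h.hittingTime_eq hpos]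
  exact setLIntegral_path (x := fun k => J k w) (fun y => ENNReal.ofReal (extend ω y))
    h.jumpTime_lt_top

theorem additive_zero (Y : ℝ≥0 → Ω → Option ℕ) (a : ℕ) (w : Ω) : additive Y 0 a w = 0 := by
  have hextend : ∀ y : Option ℕ, extend 0 y = 0 := by rintro (_ | _) <;> rfl
  simp [additive, hextend]

/-- The discount collected during a holding time `s` in the state `y`, killing all paths which are
not above `a`. -/
def killFactor (ω : ℕ → ℝ) (a y : ℕ) (s : ℝ≥0∞) : ℝ≥0∞ :=
  if a < y then holdDiscount (ω y) s else 0

theorem measurable_killFactor (ω : ℕ → ℝ) (a y : ℕ) : Measurable (killFactor ω a y) := by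
  unfold killFactor
  split_ifs
  · exact measurable_holdDiscount _
  · exact measurable_const

/-- The discount collected until the first passage to `a`, if it happens at the `n`-th jump, and
`0` otherwise. -/
def passageTerm (J : ℕ → Ω → ℕ) (S : ℕ → Ω → ℝ≥0∞) (ω : ℕ → ℝ) (a n : ℕ) (w : Ω) : ℝ≥0∞ :=
  (∏ k : Fin n, killFactor ω a (J k w) (S k w)) * (Pi.single a 1 : ℕ → ℝ≥0∞) (J n w)

theorem IsFirstPassage.passageTerm_eq (h : IsFirstPassage J S a n w) (hpos : 0 < S n w)
    (ω : ℕ → ℝ) : passageTerm J S ω a n w =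
      ENNReal.ofReal (expNeg (additive (process J S) ω a w)) := by
  rw [passageTerm, h.state_eq, Pi.single_eq_same, mul_one, h.additive_eq hpos, expNeg_sum,
    ENNReal.ofReal_prod_of_nonneg fun k _ => expNeg_nonneg _, Finset.prod_range]
  refine Finset.prod_congr rfl fun k _ => ?_
  rw [killFactor, if_pos (h.lt_state k k.2), holdDiscount, if_neg (h.hold_ne_top k k.2)]

theorem isFirstPassage_of_passageTerm_ne_zero (h : passageTerm J S ω a n w ≠ 0) :
    IsFirstPassage J S a n w := by
  have hkill : ∀ k < n, killFactor ω a (J k w) (S k w) ≠ 0 := fun k hk =>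
    Finset.prod_ne_zero_iff.mp (left_ne_zero_of_mul h) ⟨k, hk⟩ (Finset.mem_univ _)
  refine ⟨?_, fun k hk => ?_, fun k hk htop => hkill k hk ?_⟩
  · by_contra hn
    exact right_ne_zero_of_mul h (Pi.single_eq_of_ne hn 1)
  · by_contra hle
    exact hkill k hk (if_neg hle)
  · simp [killFactor, holdDiscount, htop]

theorem IsFirstPassage.unique {m : ℕ} (hm : IsFirstPassage J S a m w)
    (hn : IsFirstPassage J S a n w) : m = n :=
  le_antisymm (not_lt.mp fun h => (hm.lt_state n h).ne' hn.state_eq)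
    (not_lt.mp fun h => (hn.lt_state m h).ne' hm.state_eq)

theorem tsum_passageTerm (ω : ℕ → ℝ) (h0 : a ≤ J 0 w)
    (hstep : ∀ k, 0 < S k w ∧ J k w ≤ J (k + 1) w + 1) :
    ∑' n, passageTerm J S ω a n w = {w | hittingTime (process J S) a w < ⊤}.indicator
      (fun w => ENNReal.ofReal (expNeg (additive (process J S) ω a w))) w := by
  by_cases hhit : hittingTime (process J S) a w < ⊤
  · obtain ⟨n, hn⟩ :=
      exists_isFirstPassage_of_hittingTime_lt_top le_rfl h0 (fun k => (hstep k).2) hhit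
    rw [Set.indicator_of_mem (Set.mem_ofPred_eq ▸ hhit), ← hn.passageTerm_eq (hstep n).1]
    refine tsum_eq_single n fun m hm => ?_
    by_contra hne
    exact hm ((isFirstPassage_of_passageTerm_ne_zero hne).unique hn)
  · rw [Set.indicator_of_notMem (Set.mem_ofPred_eq ▸ hhit), ENNReal.tsum_eq_zero]
    intro n
    by_contra hne
    have hn := isFirstPassage_of_passageTerm_ne_zero hne
    exact hhit ((hn.hittingTime_eq (hstep n).1).trans_lt hn.jumpTime_lt_top)

end FirstPassage

section LaplaceTransform

variable {q : ℕ → ℕ → ℝ} {ω : ℕ → ℝ} {Ω : Type*} [MeasurableSpace Ω] {P : ℕ → Measure Ω}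
  {J : ℕ → Ω → ℕ} {S : ℕ → Ω → ℝ≥0∞} {a i : ℕ}

theorem IsSingleDeathRate.lintegral_killFactor (hq : IsSingleDeathRate q)
    (hω : ∀ i, 1 ≤ i → 0 ≤ ω i) (a y : ℕ) :
    ∫⁻ s, killFactor ω a y s ∂holdLaw (exitRate q y) = if a < y then discount q ω y else 0 := by
  unfold killFactor
  split_ifs with h
  · exact lintegral_holdDiscount (hq.exitRate_pos (by omega)) (hω y (by omega))
  · exact lintegral_zero

theorem IsMinimalChain.measurable_passageTerm (hc : IsMinimalChain q P J S) (ω : ℕ → ℝ)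
    (a n : ℕ) : Measurable (passageTerm J S ω a n) := by
  have hkill : Measurable fun z : ℕ × ℝ≥0∞ => killFactor ω a z.1 z.2 :=
    measurable_from_prod_countable_right (measurable_killFactor ω a)
  exact Measurable.mul (Finset.measurable_fun_prod _ fun k _ =>
    hkill.comp ((hc.measurable_state k).prodMk (hc.measurable_hold k)))
    (measurable_from_nat.comp (hc.measurable_state n))

theorem IsMinimalChain.lintegral_passageTerm (hc : IsMinimalChain q P J S)
    (hq : IsSingleDeathRate q) (hω : ∀ i, 1 ≤ i → 0 ≤ ω i) (a n i : ℕ) :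
    ∫⁻ w, passageTerm J S ω a n w ∂P i =
      (applyKernel (killedKernel q ω a))^[n] (Pi.single a 1) i := by
  have hterm : ∀ x : Fin (n + 1) → ℕ, ∫⁻ w in history J S x, passageTerm J S ω a n w ∂P i =
      pathWeight (killedKernel q ω a) i x *
        (Pi.single a 1 : ℕ → ℝ≥0∞) (x (Fin.last n)) := fun x => by
    have hstates : ∀ w ∈ history J S x, passageTerm J S ω a n w =
        (∏ k : Fin n, killFactor ω a (x k.castSucc) (S k w)) *
          (Pi.single a 1 : ℕ → ℝ≥0∞) (x (Fin.last n)) := fun w hw => by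
      have hlast : J n w = x (Fin.last n) := (hw (Fin.last n)).1
      rw [passageTerm, hlast]
      congr 1
      exact Finset.prod_congr rfl fun k _ => congrArg (killFactor ω a · _) (hw k.castSucc).1
    have hfinite : (Pi.single a 1 : ℕ → ℝ≥0∞) (x (Fin.last n)) ≠ ⊤ := by
      rw [Pi.single_apply]
      split_ifs <;> simp
    rw [setLIntegral_congr_fun (hc.measurableSet_history x) hstates,
      lintegral_mul_const' _ _ hfinite,
      hc.setLIntegral_history_prod hq i x fun k => measurable_killFactor ω a _,
      pathWeight_killedKernel]
    simp only [hq.lintegral_killFactor hω]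
  calc ∫⁻ w, passageTerm J S ω a n w ∂P i
      = ∫⁻ w in ⋃ x : Fin (n + 1) → ℕ, history J S x, passageTerm J S ω a n w ∂P i := by
        rw [← setLIntegral_univ]
        exact (setLIntegral_congr (eventuallyEq_univ.mpr (hc.ae_mem_iUnion_history hq i n))).symm
    _ = ∑' x : Fin (n + 1) → ℕ, pathWeight (killedKernel q ω a) i x *
          (Pi.single a 1 : ℕ → ℝ≥0∞) (x (Fin.last n)) := by
        rw [lintegral_iUnion hc.measurableSet_history fun _ _ => disjoint_history]
        exact tsum_congr hterm
    _ = (applyKernel (killedKernel q ω a))^[n] (Pi.single a 1) i := tsum_pathWeight_mul ..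

theorem IsMinimalChain.tsum_passageTerm_ae_eq (hc : IsMinimalChain q P J S)
    (hq : IsSingleDeathRate q) (ω : ℕ → ℝ) (hi : a ≤ i) :
    (fun w => ∑' n, passageTerm J S ω a n w) =ᵐ[P i]
      {w | hittingTime (process J S) a w < ⊤}.indicator
        fun w => ENNReal.ofReal (expNeg (additive (process J S) ω a w)) := by
  filter_upwards [hc.ae_start_and_step hq i] with w ⟨hstart, hstep⟩
  exact tsum_passageTerm ω (hi.trans_eq hstart.symm) hstep

theorem IsMinimalChain.lintegral_expNeg_additive (hc : IsMinimalChain q P J S)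
    (hq : IsSingleDeathRate q) (hω : ∀ i, 1 ≤ i → 0 ≤ ω i) (hi : a ≤ i) :
    ∫⁻ w, {w | hittingTime (process J S) a w < ⊤}.indicator
      (fun w => ENNReal.ofReal (expNeg (additive (process J S) ω a w))) w ∂P i =
        hitProb q ω a i := by
  rw [← lintegral_congr_ae (hc.tsum_passageTerm_ae_eq hq ω hi),
    lintegral_tsum fun n => (hc.measurable_passageTerm ω a n).aemeasurable]
  exact tsum_congr fun n => hc.lintegral_passageTerm hq hω a n i

theorem IsMinimalChain.ae_hittingTime_lt_top {b : ℕ} (hc : IsMinimalChain q P J S)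
    (hq : IsSingleDeathRate q) (hba : b ≤ a) (hi : a ≤ i)
    (hhit : ∀ᵐ w ∂P i, hittingTime (process J S) b w < ⊤) :
    ∀ᵐ w ∂P i, hittingTime (process J S) a w < ⊤ := by
  filter_upwards [hc.ae_start_and_step hq i, hhit] with w ⟨hstart, hstep⟩ hb
  obtain ⟨n, hn⟩ := exists_isFirstPassage_of_hittingTime_lt_top hba (hi.trans_eq hstart.symm)
    (fun k => (hstep k).2) hb
  exact (hn.hittingTime_eq (hstep n).1).trans_lt hn.jumpTime_lt_top

theorem IsMinimalChain.integral_expNeg_additive (hc : IsMinimalChain q P J S)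
    (hq : IsSingleDeathRate q) (hω : ∀ i, 1 ≤ i → 0 ≤ ω i) (hi : a ≤ i)
    (hhit : ∀ᵐ w ∂P i, hittingTime (process J S) a w < ⊤) :
    ∫ w, expNeg (additive (process J S) ω a w) ∂P i = (hitProb q ω a i).toReal := by
  have hindicator : ∀ᵐ w ∂P i, {w | hittingTime (process J S) a w < ⊤}.indicator
      (fun w => ENNReal.ofReal (expNeg (additive (process J S) ω a w))) w =
        ENNReal.ofReal (expNeg (additive (process J S) ω a w)) := by
    filter_upwards [hhit] with w hw using Set.indicator_of_mem (Set.mem_ofPred_eq ▸ hw) _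
  have hmeas : AEMeasurable
      (fun w => ENNReal.ofReal (expNeg (additive (process J S) ω a w))) (P i) :=
    (Measurable.tsum (hc.measurable_passageTerm ω a)).aemeasurable.congr
      ((hc.tsum_passageTerm_ae_eq hq ω hi).trans hindicator)
  rw [← hc.lintegral_expNeg_additive hq hω hi, lintegral_congr_ae hindicator,
    ← integral_toReal hmeas (ae_of_all _ fun _ => ENNReal.ofReal_lt_top)]
  simp only [ENNReal.toReal_ofReal (expNeg_nonneg _)]

theorem IsMinimalChain.hitProb_zero_eq_one (hc : IsMinimalChain q P J S)
    (hq : IsSingleDeathRate q) (hi : a ≤ i)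
    (hhit : ∀ᵐ w ∂P i, hittingTime (process J S) a w < ⊤) : hitProb q 0 a i = 1 := by
  have := hc.prob i
  have hint := hc.integral_expNeg_additive hq (ω := 0) (fun _ _ => le_rfl) hi hhit
  simp only [additive_zero, expNeg_zero, integral_const, probReal_univ, smul_eq_mul,
    mul_one] at hint
  exact (ENNReal.toReal_eq_one_iff _).mp hint.symm

end LaplaceTransform

end SingleDeath

end

theorem mainTheorem6 {Ω : Type*} [MeasurableSpace Ω]
    (q : ℕ → ℕ → ℝ) (hq : SingleDeath.IsSingleDeathRate q)
    (P : ℕ → Measure Ω) (J : ℕ → Ω → ℕ) (S : ℕ → Ω → ℝ≥0∞)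
    (hchain : SingleDeath.IsMinimalChain q P J S)
    (Y : ℝ≥0 → Ω → Option ℕ) (hY : Y = SingleDeath.process J S)
    (ω : ℕ → ℝ) (hω : ∀ i, 1 ≤ i → 0 ≤ ω i)
    (hhit : ∀ i, 1 ≤ i → ∀ᵐ w ∂(P i), SingleDeath.hittingTime Y 0 w < ⊤) :
    (∀ a i : ℕ, a < i →
      Tendsto (fun N => SingleDeath.W q ω i N / SingleDeath.W q ω a N) atTop
        (𝓝 (∫ w, SingleDeath.expNeg (SingleDeath.additive Y ω a w) ∂(P i))) ∧
      Tendsto (fun N => SingleDeath.Z q ω i N / SingleDeath.Z q ω a N) atTop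
        (𝓝 (∫ w, SingleDeath.expNeg (SingleDeath.additive Y ω a w) ∂(P i)))) ∧
    (Summable (fun u => ω (u + 1) * SingleDeath.W q 0 0 (u + 1)) →
      (∀ i : ℕ, Summable (fun u => ω (i + 1 + u) * SingleDeath.W q ω i (i + 1 + u))) ∧
      (∀ a i : ℕ, a < i →
        ∫ w, SingleDeath.expNeg (SingleDeath.additive Y ω a w) ∂(P i) =
          SingleDeath.ZInf q ω i / SingleDeath.ZInf q ω a)) := by
  subst hY
  have hprob : ∀ a i : ℕ, a < i → SingleDeath.hitProb q 0 a i = 1 ∧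
      ∫ w, SingleDeath.expNeg (SingleDeath.additive (SingleDeath.process J S) ω a w) ∂(P i) =
        (SingleDeath.hitProb q ω a i).toReal := fun a i h => by
    have hhit_a := hchain.ae_hittingTime_lt_top hq a.zero_le h.le (hhit i (by omega))
    exact ⟨hchain.hitProb_zero_eq_one hq h.le hhit_a,
      hchain.integral_expNeg_additive hq hω h.le hhit_a⟩
  refine ⟨fun a i h => ?_, fun hs => ?_⟩
  · rw [(hprob a i h).2]
    exact ⟨hq.tendsto_scaleRatio hω h.le, hq.tendsto_Z_div hω h.le (hprob a i h).1⟩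
  · have hsum := hq.summable_weight_mul_W hω ((summable_nat_add_iff 1).mp hs)
    refine ⟨fun i => (hsum i).comp_injective (add_right_injective (i + 1)), fun a i h => ?_⟩
    rw [(hprob a i h).2]
    exact tendsto_nhds_unique (hq.tendsto_Z_div hω h.le (hprob a i h).1)
      ((SingleDeath.tendsto_Z_ZInf (hsum i)).div (SingleDeath.tendsto_Z_ZInf (hsum a))
        (zero_lt_one.trans_le (hq.one_le_ZInf hω a)).ne')
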